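/- **Definitions.** An \emph{induced system of linear equations} is a pair $(M,\sigma)$, where $M$ is an $m\times k$ matrix over $\mathbb F_2$ with $m>0$, $k>2$, and $\sigma\in\{0,1\}^k$. For an $\mathbb F_2$-vector space $V$, a function $f:V\to\{0,1\}$ \emph{induces} $(M,\sigma)$ at $x=(x_1,\dots,x_k)\in V^k$ if $Mx=0$ and $f(x_i)=\sigma_i$ for all $i$. For a (possibly infinite) set $\mathcal F$ of induced systems, $f$ is \emph{$\mathcal F$-free} if it induces no $(M,\sigma)\in\mathcal F$ at any $x$. The matrix $M$ has \emph{(Cauchy–Schwarz) complexity $c$} if $c$ is the smallest positive integer such that for every $i\in[k]$ there is a partition of $[k]\setminus\{i\}$ into $c+1$ (possibly empty) sets $S_1,\dots,S_{c+1}$ with the property that, for every $j$ and every $T\subseteq S_j$, the vector $\mathbf e_i+\sum_{i'\in T}\mathbf e_{i'}$ is not in the row space of $M$. A function $f:\mathbb F_2^n\to\{0,1\}$ is \emph{$\varepsilon$-far} from a property $\mathcal P$ if it differs from every $g:\mathbb F_2^n\to\{0,1\}$ in $\mathcal P$ on at least $\varepsilon 2^n$ points. A \emph{one-sided tester} for $\mathcal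 P$ with parameter $\varepsilon$ is a randomized (possibly adaptive) query algorithm that accepts every $f\in\mathcal P$ with probability $1$ and rejects every $f$ that is $\varepsilon$-far from $\mathcal P$ with probability at least $2/3$. $\mathcal P$ is \emph{testable with one-sided error} if for every $\varepsilon\in(0,1)$ and every $n$ there is a one-sided tester for $\mathcal P$ on $\mathbb F_2^n$ whose number of queries is bounded in terms of $\varepsilon$ only, independently of $n$. Functions $N_{\mathcal F},k_{\mathcal F}:(0,1)\to\mathbb N$ and $\delta_{\mathcal F}:(0,1)\to(0,1]$ are \emph{admissible} for $\mathcal F$ if for all $\varepsilon\in(0,1)$, all $n>N_{\mathcal F}(\varepsilon)$ and all $f:\mathbb F_2^n\to\{0,1\}$ that are $\varepsilon$-far from being $\mathcal F$-free, there is an $(M,\sigma)\in\mathcal F$ with $k\le k_{\mathcal F}(\varepsilon)$ columns that $f$ induces at no fewer than $\delta_{\mathcal F}(\varepsilon)\,2^{n(k-\operatorname{rank}M)}$ tuples $x\in(\mathbb F_2^n)^k$. **Theorem.** There is an absolute constant $C>0$ such that the following holds. Let $\mathcal F=\{(M^1,\sigma^1),(M^2,\sigma^2),\dots\}$ be a possibly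 infinite set of induced systems of linear equations in which each $M^i$ has complexity $1$. Then: 1. The property of being $\mathcal F$-free is testable with one-sided error. 2. Admissible functions $N_{\mathcal F},k_{\mathcal F},\delta_{\mathcal F}$ for $\mathcal F$ exist. 3. For all admissible $N_{\mathcal F},k_{\mathcal F},\delta_{\mathcal F}$, all $\varepsilon\in(0,1)$ and all $n$, the following algorithm is a one-sided tester, with parameter $\varepsilon$, for $\mathcal F$-freeness of $f:\mathbb F_2^n\to\{0,1\}$. If $n\le N_{\mathcal F}(\varepsilon)$, query $f$ everywhere and accept iff $f$ is $\mathcal F$-free. Otherwise choose $d=\lceil C\,k_{\mathcal F}(\varepsilon)/\delta_{\mathcal F}(\varepsilon)\rceil$ independent uniformly random points of $\mathbb F_2^n$, query $f$ on all points of their linear span, and accept iff the restriction of $f$ to the span is $\mathcal F$-free. It makes at most $\max(2^{N_{\mathcal F}(\varepsilon)},2^{d})$ queries. -/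

import Mathlib

open scoped ENNReal

/-- The vector space `𝔽₂ⁿ`. -/
abbrev Cube (n : ℕ) : Type := Fin n → ZMod 2

/-! ### Complexity of linear systems -/

/-- The subspace of `𝔽₂ᵏ` spanned by the rows of `M`. -/
def rowSpace {m k : ℕ} (M : Matrix (Fin m) (Fin k) (ZMod 2)) :
    Submodule (ZMod 2) (Fin k → ZMod 2) :=
  Submodule.span (ZMod 2) (Set.range M.row)

/-- The variable `xᵢ` is linearly dependent on the variables `(xⱼ)`, `j ∈ S`, modulo the relations
in the row space of `M`: some relation expresses `xᵢ` as a sum of variables indexed by a subset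
of `S`. -/
def VarDependsOn {m k : ℕ} (M : Matrix (Fin m) (Fin k) (ZMod 2)) (i : Fin k)
    (S : Finset (Fin k)) : Prop :=
  ∃ T ⊆ S, (Pi.single i 1 + ∑ j ∈ T, Pi.single j 1 : Fin k → ZMod 2) ∈ rowSpace M

/-- For every `i`, the indices different from `i` can be partitioned into `c + 1` (possibly empty)
classes such that `xᵢ` does not depend on the variables of any single class. -/
def HasComplexityAtMost {m k : ℕ} (M : Matrix (Fin m) (Fin k) (ZMod 2)) (c : ℕ) : Prop :=
  ∀ i : Fin k, ∃ S : Fin (c + 1) → Finset (Fin k),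
    (∀ a b, a ≠ b → Disjoint (S a) (S b)) ∧
    (∀ l : Fin k, l ≠ i ↔ ∃ a, l ∈ S a) ∧
    ∀ a, ¬ VarDependsOn M i (S a)

/-- `M` has (Cauchy–Schwarz) complexity `c`: `c` is the least positive integer for which the
partitions above exist. -/
def HasComplexity {m k : ℕ} (M : Matrix (Fin m) (Fin k) (ZMod 2)) (c : ℕ) : Prop :=
  IsLeast {c : ℕ | 0 < c ∧ HasComplexityAtMost M c} c

/-! ### Induced systems of equations and freeness -/

/-- An induced system of linear equations `(M, σ)` over `𝔽₂`. -/
structure InducedSystem where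
  m : ℕ
  k : ℕ
  m_pos : 0 < m
  two_lt_k : 2 < k
  M : Matrix (Fin m) (Fin k) (ZMod 2)
  σ : Fin k → Bool

/-- `f` induces `(M, σ)` at `x`: `M x = 0` and `f xᵢ = σᵢ` for all `i`. -/
def InducedSystem.InducedAt (S : InducedSystem) {V : Type} [AddCommGroup V] [Module (ZMod 2) V]
    (f : V → Bool) (x : Fin S.k → V) : Prop :=
  (∀ r : Fin S.m, ∑ j, S.M r j • x j = 0) ∧ ∀ j, f (x j) = S.σ j

/-- `f` is `𝓕`-free. The domain is an arbitrary `𝔽₂`-vector space, so that the notion applies to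
restrictions of functions to subspaces. -/
def IsFree (F : Set InducedSystem) {V : Type} [AddCommGroup V] [Module (ZMod 2) V]
    (f : V → Bool) : Prop :=
  ∀ S ∈ F, ¬ ∃ x : Fin S.k → V, S.InducedAt f x

/-- A property of Boolean functions on the hypercubes: a set of functions for every dimension. -/
abbrev BoolProperty : Type := ∀ n : ℕ, Set (Cube n → Bool)

/-- The property of being `𝓕`-free. -/
def freeness (F : Set InducedSystem) : BoolProperty := fun _ => {f | IsFree F f}

/-- `f` is `ε`-far from `P`: it differs from every member of `P` on at least `ε 2ⁿ` points. -/
def IsFar (P : BoolProperty) (ε : ℝ) {n : ℕ} (f : Cube n → Bool) : Prop :=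
  ∀ g ∈ P n, ε * 2 ^ n ≤ (hammingDist f g : ℝ)

/-! ### Testers -/

/-- A deterministic adaptive query algorithm with oracle access to a function `X → Bool`. -/
inductive QueryTree (X : Type) : Type
  | answer (accept : Bool) : QueryTree X
  | query (x : X) (next : Bool → QueryTree X) : QueryTree X

namespace QueryTree

/-- The verdict on input `f` (`true` is acceptance). -/
def run {X : Type} (f : X → Bool) : QueryTree X → Bool
  | answer b => b
  | query x next => run f (next (f x))

/-- The worst-case number of queries. -/
def queries {X : Type} : QueryTree X → ℕ
  | answer _ => 0
  | query _ next => max (queries (next false)) (queries (next true)) + 1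

/-- Query all points of the list, record the answers by updating the table `g`, and decide by
applying `decision` to the resulting table. -/
def queryAll {X : Type} [DecidableEq X] (decision : (X → Bool) → Bool) :
    List X → (X → Bool) → QueryTree X
  | [], g => answer (decision g)
  | x :: L, g => query x fun b => queryAll decision L (Function.update g x b)

end QueryTree

/-- A randomized query algorithm: a probability distribution on deterministic ones. -/
abbrev RandomizedTester (n : ℕ) : Type := PMF (QueryTree (Cube n))

/-- The probability that `T` returns the verdict `b` on input `f`. -/
noncomputable def verdictProb {n : ℕ} (T : RandomizedTester n) (f : Cube n → Bool) (b : Bool) :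
    ℝ≥0∞ :=
  (T.map fun t => t.run f) b

/-- `T` is a one-sided error tester for `P` on functions on `𝔽₂ⁿ` with distance parameter `ε`
making at most `q` queries. -/
def IsOneSidedTester (P : BoolProperty) (ε : ℝ) (q : ℕ) {n : ℕ} (T : RandomizedTester n) : Prop :=
  (∀ t ∈ T.support, t.queries ≤ q) ∧
  (∀ f ∈ P n, verdictProb T f true = 1) ∧
  (∀ f : Cube n → Bool, IsFar P ε f → 2 / 3 ≤ verdictProb T f false)

/-- `P` is testable with one-sided error: the number of queries may depend on `ε` but not
on `n`. -/
def TestableOneSided (P : BoolProperty) : Prop :=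
  ∃ q : ℝ → ℕ, ∀ ε : ℝ, 0 < ε → ε < 1 → ∀ n : ℕ,
    ∃ T : RandomizedTester n, IsOneSidedTester P ε (q ε) T

open Classical in
/-- Query `f` on all points of the subspace `H`; accept iff the restriction of `f` to `H` is
`𝓕`-free. -/
noncomputable def subspaceTest (F : Set InducedSystem) {n : ℕ}
    (H : Submodule (ZMod 2) (Cube n)) : QueryTree (Cube n) :=
  QueryTree.queryAll (fun g => decide (IsFree F fun v : H => g v))
    (Finset.univ.filter fun x => x ∈ H).toList (fun _ => false)

/-- If `n ≤ N`, query the whole domain and accept iff `f` is `𝓕`-free. Otherwise draw `d`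
independent uniform points of `𝔽₂ⁿ`, query `f` on their span, and accept iff the restriction of `f`
to the span is `𝓕`-free. -/
noncomputable def spanTester (F : Set InducedSystem) (N d n : ℕ) : RandomizedTester n :=
  if n ≤ N then PMF.pure (subspaceTest F ⊤)
  else (PMF.uniformOfFintype (Fin d → Cube n)).map fun D =>
    subspaceTest F (Submodule.span (ZMod 2) (Set.range D))

/-! ### The parameters of a family -/

/-- `N`, `k`, `δ` are admissible parameters for `𝓕`: for `n > N ε`, every function on `𝔽₂ⁿ` that is
`ε`-far from `𝓕`-free induces some `(M, σ) ∈ 𝓕` with at most `k ε` variables at a proportion of at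
least `δ ε` of the `2 ^ (n (k - rank M))` solutions of `M x = 0`. -/
def AdmissibleParameters (F : Set InducedSystem) (N k : ℝ → ℕ) (δ : ℝ → ℝ) : Prop :=
  ∀ ε : ℝ, 0 < ε → ε < 1 →
    0 < δ ε ∧ δ ε ≤ 1 ∧
    ∀ n : ℕ, N ε < n → ∀ f : Cube n → Bool, IsFar (freeness F) ε f →
      ∃ S ∈ F, S.k ≤ k ε ∧
        δ ε * 2 ^ (n * (S.k - S.M.rank)) ≤
          ({x : Fin S.k → Cube n | S.InducedAt f x}.ncard : ℝ)

/-!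
That the span of random points is a good test set is elementary. If `f` induces `(M, σ)` at a
proportion `δ` of the solutions, parametrise the solutions by `l`-tuples of points, where
`l = k - rank M`, so that the entries of a solution lie in the span of its parameters
(`exists_solutions_param`). Then `d ≥ 3 k / δ` random points contain `d / l` disjoint independent
blocks of length `l`, and all of them miss the set of good parameters with probability at most
`(1 - δ) ^ (d / l) ≤ exp (-2) ≤ 1 / 3` (`card_avoiding_le`, `one_sub_pow_le_third`). So the
constant `3` works, and testability follows from the existence of admissible parameters, which is
an induced removal lemma, `exists_induced_removal`.

The removal lemma rests on Fourier analysis. Complexity one gives, for every variable `xᵢ`, two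
directions in the solution space along both of which `xᵢ` moves, while every other variable is
constant along one of them. Hence the average of `∏ fⱼ (xⱼ)`, for functions bounded by one, over
the solutions is at most the largest Fourier coefficient of `fᵢ`
(`HasComplexityAtMost.abs_expect_prod_le`), and on cosets of a subspace where `f` has no large
nontrivial Fourier coefficient, solutions are distributed as if the values of `f` were independent
(`HasComplexityAtMost.le_expect_prod`).

An energy increment argument, applied twice, gives subspaces `H' ≤ H` of bounded codimension such
that `f` is uniform on almost all cosets of `H'`, to a degree that may depend on the codimension
of `H`, and has on most of them nearly the same density as on the surrounding coset of `H`
(`exists_strongly_regular_pair`). A random linear section of `V → V ⧸ H` then represents every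
nonzero class by a coset of `H'` on which `f` is uniform (`exists_good_section`). The class `H`
itself cannot be represented in this way, since the section maps zero to zero. Instead, a Ramsey
theorem for vector spaces yields, inside `H'`, a linearly indexed family of cosets of a subspace
`H''` all of which, except the one with index zero, are uniform and have one and the same majority
colour (`exists_mono_cosets`). As `f` is so uniform on the representing cosets of `H'`, it remains
uniform, with almost the same density, on their translates by this family, taken modulo `H''`.

Recolour `H` by that colour, and remove from every other class a colour that is rare on its
representative (`exists_recolouring`). This changes few values, so if `f` is far from free, then
the new function still induces some system in `F`. The system may be large, but whether a system
is compatible with the pattern of allowed colours depends on `V ⧸ H` only, and there are finitely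
many patterns of bounded dimension; so it can be replaced by one of bounded size
(`exists_bound_allowedBy`). Add to the representatives of its solution in `V ⧸ H` a solution
without zero entries in the index space of the Ramsey family; the counting lemma then finds many
solutions in the resulting cosets of `H''` at which `f` has the prescribed colours.
-/

open scoped BigOperators

-- Subspaces, quotients and spaces of linear maps are summed over through this instance.
attribute [local instance] Fintype.ofFinite

/-! ### Fourier analysis on finite `𝔽₂`-vector spaces -/

/-- The nontrivial additive character of `𝔽₂`, with real values. -/
def sgn (a : ZMod 2) : ℝ := if a = 0 then 1 else -1

@[simp] lemma sgn_zero : sgn 0 = 1 := by simp [sgn]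

lemma sgn_one : sgn 1 = -1 := by simp [sgn]

lemma zmod_two_eq_zero_or_one (a : ZMod 2) : a = 0 ∨ a = 1 := by
  revert a; decide

lemma sgn_add (a b : ZMod 2) : sgn (a + b) = sgn a * sgn b := by
  have h : (1 + 1 : ZMod 2) = 0 := by decide
  rcases zmod_two_eq_zero_or_one a with rfl | rfl <;>
    rcases zmod_two_eq_zero_or_one b with rfl | rfl <;> simp [sgn_one, h]

lemma sgn_mul_self (a : ZMod 2) : sgn a * sgn a = 1 := by
  rcases zmod_two_eq_zero_or_one a with rfl | rfl <;> simp [sgn_one]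

@[simp] lemma abs_sgn (a : ZMod 2) : |sgn a| = 1 := by
  rcases zmod_two_eq_zero_or_one a with rfl | rfl <;> simp [sgn_one]

instance finite_linearMap_zmod_two {V W : Type*} [AddCommGroup V] [Module (ZMod 2) V]
    [AddCommGroup W] [Module (ZMod 2) W] [Finite V] [Finite W] : Finite (V →ₗ[ZMod 2] W) :=
  DFunLike.finite _

lemma expect_translate {W : Type*} [AddCommGroup W] [Fintype W] (F : W → ℝ) (a : W) :
    𝔼 x, F (a + x) = 𝔼 x, F x :=
  Fintype.expect_equiv (Equiv.addLeft a) _ _ fun _ => rfl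

section Fourier

variable {W : Type*} [AddCommGroup W] [Module (ZMod 2) W] [Fintype W]

/-- The Fourier (Walsh) coefficient of `F` at the character `x ↦ (-1) ^ ℓ x`. -/
noncomputable def walsh (F : W → ℝ) (l : Module.Dual (ZMod 2) W) : ℝ :=
  𝔼 x, F x * sgn (l x)

lemma walsh_zero (F : W → ℝ) : walsh F 0 = 𝔼 x, F x := by simp [walsh]

lemma walsh_translate (F : W → ℝ) (l : Module.Dual (ZMod 2) W) (a : W) :
    walsh (fun x => F (a + x)) l = sgn (l a) * walsh F l := by
  unfold walsh
  rw [← expect_translate (fun x => F x * sgn (l x)) a, Finset.mul_expect]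
  refine Finset.expect_congr rfl fun x _ => ?_
  rw [map_add, sgn_add]
  linear_combination (-F (a + x) * sgn (l x)) * sgn_mul_self (l a)

lemma walsh_sub (F G : W → ℝ) (l : Module.Dual (ZMod 2) W) :
    walsh (fun x => F x - G x) l = walsh F l - walsh G l := by
  simp only [walsh, sub_mul, Finset.expect_sub_distrib]

lemma walsh_const (c : ℝ) {l : Module.Dual (ZMod 2) W} (hl : l ≠ 0) :
    walsh (fun _ => c) l = 0 := by
  obtain ⟨a, ha⟩ : ∃ a, l a ≠ 0 := by
    by_contra! h
    exact hl (LinearMap.ext h)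
  have h1 : l a = 1 := (zmod_two_eq_zero_or_one _).resolve_left ha
  have := walsh_translate (fun _ => c) l a
  rw [h1, sgn_one] at this
  linarith

lemma card_dual_zmod_two :
    Fintype.card (Module.Dual (ZMod 2) W) = Fintype.card W := by
  rw [Module.card_eq_pow_finrank (K := ZMod 2) (V := W),
    Module.card_eq_pow_finrank (K := ZMod 2) (V := Module.Dual (ZMod 2) W),
    Subspace.dual_finrank_eq]

/-- Orthogonality of characters. -/
lemma sum_dual_sgn_of_ne {x : W} (hx : x ≠ 0) :
    ∑ l : Module.Dual (ZMod 2) W, sgn (l x) = 0 := by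
  obtain ⟨l₀, h₀⟩ : ∃ l : Module.Dual (ZMod 2) W, l x ≠ 0 := by
    by_contra! h
    exact hx ((Module.forall_dual_apply_eq_zero_iff (ZMod 2) x).1 h)
  have h1 : l₀ x = 1 := (zmod_two_eq_zero_or_one _).resolve_left h₀
  have h2 := Fintype.sum_equiv (Equiv.addLeft l₀)
    (fun l : Module.Dual (ZMod 2) W => sgn ((l₀ + l) x)) (fun l => sgn (l x)) fun _ => rfl
  simp only [LinearMap.add_apply, sgn_add, h1, sgn_one, ← Finset.mul_sum] at h2
  linarith

lemma sum_dual_sgn_zero :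
    ∑ l : Module.Dual (ZMod 2) W, sgn (l 0) = Fintype.card W := by
  simp [card_dual_zmod_two]

open Classical in
lemma sum_dual_sgn (x : W) :
    ∑ l : Module.Dual (ZMod 2) W, sgn (l x) = if x = 0 then (Fintype.card W : ℝ) else 0 := by
  split_ifs with h
  · rw [h, sum_dual_sgn_zero]
  · exact sum_dual_sgn_of_ne h

lemma walsh_inversion (F : W → ℝ) (x : W) :
    F x = ∑ l : Module.Dual (ZMod 2) W, walsh F l * sgn (l x) := by
  classical
  have hW : (Fintype.card W : ℝ) ≠ 0 := by exact_mod_cast Fintype.card_ne_zero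
  have key : ∀ y, ∑ l : Module.Dual (ZMod 2) W, F y * sgn (l y) * sgn (l x)
      = if y = x then F y * Fintype.card W else 0 := by
    intro y
    simp_rw [mul_assoc, ← sgn_add, ← map_add, ← Finset.mul_sum, sum_dual_sgn]
    have : y + x = 0 ↔ y = x := by
      rw [add_eq_zero_iff_eq_neg, ZModModule.neg_eq_self]
    simp only [this]
    split_ifs <;> simp
  simp only [walsh, Finset.expect_mul, ← Finset.expect_sum_comm, key]
  rw [Fintype.expect_eq_sum_div_card]
  simp [hW]

/-- Plancherel's identity. -/
lemma sum_walsh_mul_walsh (F G : W → ℝ) :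
    ∑ l : Module.Dual (ZMod 2) W, walsh F l * walsh G l = 𝔼 x, F x * G x := by
  have h : ∀ x, F x * G x = ∑ l : Module.Dual (ZMod 2) W, walsh F l * (G x * sgn (l x)) := by
    intro x
    conv_lhs => rw [walsh_inversion F x, Finset.sum_mul]
    exact Finset.sum_congr rfl fun l _ => by ring
  simp only [h, Finset.expect_sum_comm, ← Finset.mul_expect]
  rfl

lemma sum_walsh_sq_le_one {F : W → ℝ} (hF : ∀ x, |F x| ≤ 1) :
    ∑ l : Module.Dual (ZMod 2) W, walsh F l ^ 2 ≤ 1 := by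
  simp only [pow_two, sum_walsh_mul_walsh]
  refine Finset.expect_le Finset.univ_nonempty fun x _ => ?_
  rw [← abs_mul_abs_self]
  exact mul_le_one₀ (hF x) (abs_nonneg _) (hF x)

/-- A function with small Fourier coefficients correlates with no product of a function of `a`
and a function of `b`, evaluated along `a + b`. -/
lemma abs_expect_expect_le {P Q R : W → ℝ} {η : ℝ} (hP : ∀ l, |walsh P l| ≤ η)
    (hQ : ∀ x, |Q x| ≤ 1) (hR : ∀ x, |R x| ≤ 1) :
    |𝔼 a, 𝔼 b, P (a + b) * Q a * R b| ≤ η := by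
  have hη : 0 ≤ η := (abs_nonneg _).trans (hP 0)
  have h : 𝔼 a, 𝔼 b, P (a + b) * Q a * R b
      = ∑ l : Module.Dual (ZMod 2) W, walsh P l * (walsh Q l * walsh R l) := by
    have h1 : ∀ a b, P (a + b) * Q a * R b = ∑ l : Module.Dual (ZMod 2) W,
        walsh P l * ((Q a * sgn (l a)) * (R b * sgn (l b))) := by
      intro a b
      rw [walsh_inversion P (a + b), Finset.sum_mul, Finset.sum_mul]
      exact Finset.sum_congr rfl fun l _ => by rw [map_add, sgn_add]; ring
    simp only [h1, Finset.expect_sum_comm, ← Finset.mul_expect, ← Finset.expect_mul]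
    rfl
  rw [h]
  calc |∑ l, walsh P l * (walsh Q l * walsh R l)|
      ≤ ∑ l, |walsh P l * (walsh Q l * walsh R l)| := Finset.abs_sum_le_sum_abs _ _
    _ ≤ ∑ l, η * ((walsh Q l ^ 2 + walsh R l ^ 2) / 2) := by
        refine Finset.sum_le_sum fun l _ => ?_
        rw [abs_mul]
        refine mul_le_mul (hP l) ?_ (abs_nonneg _) hη
        rw [abs_mul, ← sq_abs (walsh Q l), ← sq_abs (walsh R l)]
        nlinarith [sq_nonneg (|walsh Q l| - |walsh R l|)]
    _ = η * ((∑ l, walsh Q l ^ 2 + ∑ l, walsh R l ^ 2) / 2) := by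
        rw [← Finset.mul_sum, ← Finset.sum_div, Finset.sum_add_distrib]
    _ ≤ η * 1 := by
        refine mul_le_mul_of_nonneg_left ?_ hη
        linarith [sum_walsh_sq_le_one hQ, sum_walsh_sq_le_one hR]
    _ = η := mul_one _

/-- Poisson summation: the average over a subspace is the sum of the Fourier coefficients over its
annihilator. -/
lemma expect_subspace_eq_sum_walsh (H : Submodule (ZMod 2) W) (F : W → ℝ) :
    𝔼 h : H, F h = ∑ l : Module.Dual (ZMod 2) (W ⧸ H), walsh F (l ∘ₗ H.mkQ) := by
  have hW : (Fintype.card W : ℝ) = Fintype.card H * Fintype.card (W ⧸ H) := by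
    have := Submodule.card_eq_card_quotient_mul_card H
    simp only [Nat.card_eq_fintype_card] at this
    exact_mod_cast this
  have hH : (Fintype.card H : ℝ) ≠ 0 := by exact_mod_cast Fintype.card_ne_zero
  have hQ : (Fintype.card (W ⧸ H) : ℝ) ≠ 0 := by exact_mod_cast Fintype.card_ne_zero
  simp only [walsh, ← Finset.expect_sum_comm, LinearMap.comp_apply, ← Finset.mul_sum,
    sum_dual_sgn, Submodule.mkQ_apply, Submodule.Quotient.mk_eq_zero]
  rw [Fintype.expect_eq_sum_div_card, Fintype.expect_eq_sum_div_card, hW]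
  simp only [mul_ite, mul_zero]
  rw [← Finset.sum_filter, ← Finset.sum_mul,
    Finset.sum_subtype (p := fun x => x ∈ H) _ (by simp)]
  field_simp

/-- All nontrivial Fourier coefficients of `F` are at most `η` in absolute value. -/
def IsUniform (η : ℝ) (F : W → ℝ) : Prop :=
  ∀ l : Module.Dual (ZMod 2) W, l ≠ 0 → |walsh F l| ≤ η

lemma IsUniform.mono {η η' : ℝ} {F : W → ℝ} (h : IsUniform η F) (hη : η ≤ η') :
    IsUniform η' F := fun l hl => (h l hl).trans hη

lemma IsUniform.translate {η : ℝ} {F : W → ℝ} (h : IsUniform η F) (a : W) :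
    IsUniform η fun x => F (a + x) := fun l hl => by
  rw [walsh_translate, abs_mul, abs_sgn, one_mul]
  exact h l hl

/-- Uniformity is inherited by subspaces, with a loss of the index. -/
lemma IsUniform.restrict {η : ℝ} {F : W → ℝ} (h : IsUniform η F) (H : Submodule (ZMod 2) W) :
    IsUniform (Fintype.card (W ⧸ H) * η) fun x : H => F x := by
  intro l hl
  obtain ⟨g, rfl⟩ := LinearMap.exists_extend l
  have h1 : walsh (fun x : H => F x) (g ∘ₗ H.subtype)
      = ∑ m : Module.Dual (ZMod 2) (W ⧸ H), walsh F (g + m ∘ₗ H.mkQ) := by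
    refine (expect_subspace_eq_sum_walsh H fun x => F x * sgn (g x)).trans ?_
    refine Finset.sum_congr rfl fun m _ => ?_
    simp only [walsh, LinearMap.add_apply, sgn_add, mul_assoc]
  rw [h1]
  refine (Finset.abs_sum_le_sum_abs _ _).trans ?_
  refine (Finset.sum_le_card_nsmul _ _ η fun m _ => h _ ?_).trans_eq ?_
  · rintro h0
    refine hl (LinearMap.ext fun x => ?_)
    have h2 := LinearMap.congr_fun h0 x
    have h3 : H.mkQ (x : W) = 0 := by simp
    simpa [h3] using h2
  · rw [Finset.card_univ, card_dual_zmod_two, nsmul_eq_mul]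

/-- The average of a uniform function over a subspace of small index is close to its average. -/
lemma IsUniform.abs_expect_restrict_sub_le {η : ℝ} (hη : 0 ≤ η) {F : W → ℝ} (h : IsUniform η F)
    (H : Submodule (ZMod 2) W) :
    |𝔼 x : H, F x - 𝔼 x, F x| ≤ Fintype.card (W ⧸ H) * η := by
  classical
  rw [expect_subspace_eq_sum_walsh, ← Finset.add_sum_erase _ _ (Finset.mem_univ 0)]
  rw [LinearMap.zero_comp, walsh_zero, add_sub_cancel_left]
  refine (Finset.abs_sum_le_sum_abs _ _).trans ?_
  refine (Finset.sum_le_card_nsmul _ _ η fun m hm => h _ fun h0 => ?_).trans ?_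
  · refine (Finset.mem_erase.1 hm).1 (LinearMap.ext fun x => ?_)
    obtain ⟨y, rfl⟩ := H.mkQ_surjective x
    simpa using LinearMap.congr_fun h0 y
  · rw [nsmul_eq_mul]
    refine mul_le_mul_of_nonneg_right ?_ hη
    rw [← card_dual_zmod_two (W := W ⧸ H)]
    exact_mod_cast Finset.card_le_univ _

end Fourier

/-! ### Counting solutions of systems of complexity one -/

section Systems

variable {m k : ℕ} (M : Matrix (Fin m) (Fin k) (ZMod 2))

/-- The solutions of `M x = 0` with entries in an `𝔽₂`-vector space `W`. -/
def solutions (W : Type*) [AddCommGroup W] [Module (ZMod 2) W] :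
    Submodule (ZMod 2) (Fin k → W) where
  carrier := {x | ∀ r, ∑ j, M r j • x j = 0}
  zero_mem' := by simp
  add_mem' := by
    intro x y hx hy r
    simp only [Pi.add_apply, smul_add, Finset.sum_add_distrib]
    rw [hx r, hy r, add_zero]
  smul_mem' := by
    intro c x hx r
    simp only [Pi.smul_apply, smul_comm _ c, ← Finset.smul_sum]
    rw [hx r, smul_zero]

variable {M} {W : Type*} [AddCommGroup W] [Module (ZMod 2) W]

lemma mem_solutions {x : Fin k → W} :
    x ∈ solutions M W ↔ ∀ r, ∑ j, M r j • x j = 0 := Iff.rfl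

lemma smul_mem_solutions {v : Fin k → ZMod 2} (hv : v ∈ solutions M (ZMod 2)) (a : W) :
    (fun j => v j • a) ∈ solutions M W := by
  intro r
  have := hv r
  simp only [smul_eq_mul] at this
  simp only [smul_smul, ← Finset.sum_smul, this, zero_smul]

lemma map_mem_solutions {W' : Type*} [AddCommGroup W'] [Module (ZMod 2) W'] {x : Fin k → W}
    (hx : x ∈ solutions M W) (φ : W →ₗ[ZMod 2] W') : (fun j => φ (x j)) ∈ solutions M W' := by
  intro r
  have := congrArg φ (hx r)
  simpa using this

/-- If `xᵢ` does not depend on the variables in `S`, then some solution over `𝔽₂` vanishes on `S`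
and not at `i`. -/
lemma exists_solution_of_not_varDependsOn {i : Fin k} {S : Finset (Fin k)}
    (h : ¬ VarDependsOn M i S) :
    ∃ v ∈ solutions M (ZMod 2), v i = 1 ∧ ∀ j ∈ S, v j = 0 := by
  classical
  set p : Submodule (ZMod 2) (Fin k → ZMod 2) :=
    rowSpace M ⊔ Submodule.span (ZMod 2) ((fun j => Pi.single j 1) '' (S : Set (Fin k))) with hp
  have hi : (Pi.single i 1 : Fin k → ZMod 2) ∉ p := by
    intro hi
    obtain ⟨ρ, hρ, y, hy, hadd⟩ := Submodule.mem_sup.1 hi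
    obtain ⟨c', rfl⟩ := Submodule.mem_span_image_finset_iff_exists_fun (ZMod 2) |>.1 hy
    obtain ⟨c, hc⟩ : ∃ c : Fin k → ZMod 2, ∀ j : S, c j = c' j :=
      ⟨fun j => if hj : j ∈ S then c' ⟨j, hj⟩ else 0, fun j => by simp⟩
    refine h ⟨S.filter fun j => c j ≠ 0, Finset.filter_subset _ _, ?_⟩
    have : ∑ j ∈ S.filter fun j => c j ≠ 0, (Pi.single j 1 : Fin k → ZMod 2)
        = ∑ j : S, c' j • (Pi.single (j : Fin k) 1 : Fin k → ZMod 2) := by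
      simp only [← hc]
      rw [Finset.sum_coe_sort S fun j => c j • (Pi.single j 1 : Fin k → ZMod 2),
        Finset.sum_filter]
      refine Finset.sum_congr rfl fun j _ => ?_
      rcases zmod_two_eq_zero_or_one (c j) with h0 | h0 <;> simp [h0]
    rw [this, ← hadd, add_assoc, ZModModule.add_self, add_zero]
    exact hρ
  obtain ⟨φ, hφ, hker⟩ := Submodule.exists_le_ker_of_notMem hi
  refine ⟨fun j => φ (Pi.single j 1), fun r => ?_, ?_, fun j hj => ?_⟩
  · have hr : M.row r ∈ LinearMap.ker φ :=
      hker (Submodule.mem_sup_left (Submodule.subset_span ⟨r, rfl⟩))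
    rw [LinearMap.mem_ker, LinearMap.pi_apply_eq_sum_univ φ] at hr
    rw [← hr]
    refine Finset.sum_congr rfl fun j _ => ?_
    change _ • φ _ = _
    congr 2
    funext l
    simp [Pi.single_apply, eq_comm]
  · exact (zmod_two_eq_zero_or_one _).resolve_left hφ
  · exact hker (Submodule.mem_sup_right (Submodule.subset_span ⟨j, hj, rfl⟩))

lemma HasComplexity.hasComplexityAtMost_one (h : HasComplexity M 1) : HasComplexityAtMost M 1 :=
  h.1.2

lemma HasComplexityAtMost.exists_solution {c : ℕ} (h : HasComplexityAtMost M c) (i : Fin k) :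
    ∃ v ∈ solutions M (ZMod 2), v i = 1 := by
  obtain ⟨S, -, -, hS⟩ := h i
  obtain ⟨v, hv, hvi, -⟩ := exists_solution_of_not_varDependsOn (hS 0)
  exact ⟨v, hv, hvi⟩

/-- In a system of complexity at most one, for every `i` there are two directions in the solution
space along which `xᵢ` moves, such that every other variable is constant along one of them. -/
lemma HasComplexityAtMost.exists_pair (h : HasComplexityAtMost M 1) (i : Fin k) :
    ∃ v ∈ solutions M (ZMod 2), ∃ w ∈ solutions M (ZMod 2), v i = 1 ∧ w i = 1 ∧
      ∀ j ≠ i, v j = 0 ∨ w j = 0 := by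
  obtain ⟨S, -, hcov, hS⟩ := h i
  obtain ⟨v, hv, hvi, hv0⟩ := exists_solution_of_not_varDependsOn (hS 0)
  obtain ⟨w, hw, hwi, hw0⟩ := exists_solution_of_not_varDependsOn (hS 1)
  refine ⟨v, hv, w, hw, hvi, hwi, fun j hj => ?_⟩
  obtain ⟨a, ha⟩ := (hcov j).1 hj
  fin_cases a
  · exact Or.inl (hv0 j ha)
  · exact Or.inr (hw0 j ha)

variable [Fintype W]

/-- The generalized von Neumann inequality: for a system of complexity at most one, the average of
a product of bounded functions over the solutions is controlled by the largest Fourier coefficient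
of any one of them. -/
lemma HasComplexityAtMost.abs_expect_prod_le (h : HasComplexityAtMost M 1) (i : Fin k)
    {G : Fin k → W → ℝ} {η : ℝ} (hG : ∀ j ≠ i, ∀ x, |G j x| ≤ 1)
    (hi : ∀ l, |walsh (G i) l| ≤ η) :
    |𝔼 z : solutions M W, ∏ j, G j (z.1 j)| ≤ η := by
  obtain ⟨v, hv, w, hw, hvi, hwi, hvw⟩ := h.exists_pair i
  have h1 : 𝔼 z : solutions M W, ∏ j, G j (z.1 j)
      = 𝔼 z : solutions M W, 𝔼 a : W, 𝔼 b : W, ∏ j, G j (v j • a + w j • b + z.1 j) := by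
    have h2 : ∀ a b : W, 𝔼 z : solutions M W, ∏ j, G j (v j • a + w j • b + z.1 j)
        = 𝔼 z : solutions M W, ∏ j, G j (z.1 j) := fun a b => by
      have ht : (fun j => v j • a + w j • b) ∈ solutions M W :=
        add_mem (smul_mem_solutions hv a) (smul_mem_solutions hw b)
      have := expect_translate (fun z : solutions M W => ∏ j, G j (z.1 j)) ⟨_, ht⟩
      simpa only [Submodule.coe_add, Pi.add_apply] using this
    rw [Finset.expect_comm]
    have h3 : ∀ a : W, 𝔼 z : solutions M W, 𝔼 b : W, ∏ j, G j (v j • a + w j • b + z.1 j)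
        = 𝔼 z : solutions M W, ∏ j, G j (z.1 j) := fun a => by
      rw [Finset.expect_comm]
      simp only [h2, Fintype.expect_const]
    simp only [h3, Fintype.expect_const]
  rw [h1]
  refine (Finset.abs_expect_le _ _).trans (Finset.expect_le Finset.univ_nonempty fun z _ => ?_)
  -- The factors constant along `w` depend on `a` only, the remaining ones on `b` only.
  set A : Finset (Fin k) := (Finset.univ.erase i).filter fun j => w j = 0
  set B : Finset (Fin k) := (Finset.univ.erase i).filter fun j => ¬ w j = 0
  have h3 : ∀ a b : W, ∏ j, G j (v j • a + w j • b + z.1 j)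
      = G i (z.1 i + (a + b)) * (∏ j ∈ A, G j (v j • a + z.1 j)) *
        ∏ j ∈ B, G j (w j • b + z.1 j) := by
    intro a b
    rw [← Finset.mul_prod_erase _ _ (Finset.mem_univ i), hvi, hwi, one_smul, one_smul,
      add_comm (a + b), mul_assoc, ← Finset.prod_filter_mul_prod_filter_not _ (fun j => w j = 0)]
    congr 2
    · refine Finset.prod_congr rfl fun j hj => ?_
      rw [(Finset.mem_filter.1 hj).2, zero_smul, add_zero]
    · refine Finset.prod_congr rfl fun j hj => ?_
      have hj' := Finset.mem_filter.1 hj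
      rw [(hvw j (Finset.mem_erase.1 hj'.1).1).resolve_right hj'.2, zero_smul, zero_add]
  have hprod : ∀ (D : Finset (Fin k)), D ⊆ Finset.univ.erase i → ∀ y : Fin k → W,
      |∏ j ∈ D, G j (y j)| ≤ 1 := fun D hD y => by
    rw [Finset.abs_prod]
    exact Finset.prod_le_one (fun _ _ => abs_nonneg _)
      fun j hj => hG j (Finset.mem_erase.1 (hD hj)).1 _
  simp only [h3]
  refine abs_expect_expect_le (P := fun x => G i (z.1 i + x)) (fun l => ?_)
    (fun a => hprod A (Finset.filter_subset _ _) _) fun b => hprod B (Finset.filter_subset _ _) _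
  rw [walsh_translate, abs_mul, abs_sgn, one_mul]
  exact hi l

/-- The counting lemma: over the solutions of a system of complexity at most one, uniform functions
behave as if they were independent. -/
lemma HasComplexityAtMost.le_expect_prod (h : HasComplexityAtMost M 1)
    {F : Fin k → W → ℝ} {η : ℝ} (hη : 0 ≤ η) (hF₀ : ∀ j x, 0 ≤ F j x) (hF₁ : ∀ j x, F j x ≤ 1)
    (hF : ∀ j, IsUniform η (F j)) :
    ∏ j, 𝔼 x, F j x - k * η ≤ 𝔼 z : solutions M W, ∏ j, F j (z.1 j) := by
  set α : Fin k → ℝ := fun j => 𝔼 x, F j x with hα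
  have hα₀ : ∀ j, 0 ≤ α j := fun j => Finset.expect_nonneg fun x _ => hF₀ j x
  have hα₁ : ∀ j, α j ≤ 1 := fun j => Finset.expect_le Finset.univ_nonempty fun x _ => hF₁ j x
  -- Replace the averages by the functions one variable at a time.
  have key : ∀ J : Finset (Fin k), ∏ j, α j - J.card * η ≤
      𝔼 z : solutions M W, ∏ j, if j ∈ J then F j (z.1 j) else α j := by
    intro J
    induction J using Finset.induction_on with
    | empty => simp
    | insert i J hi ih =>
      set G : Fin k → W → ℝ := fun j x =>
        if j = i then F i x - α i else if j ∈ J then F j x else α j with hG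
      have h1 := h.abs_expect_prod_le (W := W) i (G := G) (η := η) (fun j hj x => by
        simp only [hG, if_neg hj]
        split_ifs
        · rw [abs_of_nonneg (hF₀ _ _)]; exact hF₁ _ _
        · rw [abs_of_nonneg (hα₀ _)]; exact hα₁ _) (fun l => by
        have : G i = fun x => F i x - α i := by simp [hG]
        rw [this, walsh_sub]
        by_cases hl : l = 0
        · simp [hl, walsh_zero, hα, hη]
        · rw [walsh_const _ hl, sub_zero]
          exact hF i l hl)
      have h2 : 𝔼 z : solutions M W, ∏ j, G j (z.1 j)
          = (𝔼 z : solutions M W, ∏ j, if j ∈ insert i J then F j (z.1 j) else α j)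
            - 𝔼 z : solutions M W, ∏ j, if j ∈ J then F j (z.1 j) else α j := by
        rw [← Finset.expect_sub_distrib]
        refine Finset.expect_congr rfl fun z _ => ?_
        rw [← Finset.mul_prod_erase _ _ (Finset.mem_univ i),
          ← Finset.mul_prod_erase _ _ (Finset.mem_univ i),
          ← Finset.mul_prod_erase _ _ (Finset.mem_univ i)]
        have e1 : ∏ j ∈ Finset.univ.erase i, G j (z.1 j)
            = ∏ j ∈ Finset.univ.erase i, if j ∈ J then F j (z.1 j) else α j :=
          Finset.prod_congr rfl fun j hj => by simp [hG, (Finset.mem_erase.1 hj).1]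
        have e2 : (∏ j ∈ Finset.univ.erase i, if j ∈ insert i J then F j (z.1 j) else α j)
            = ∏ j ∈ Finset.univ.erase i, if j ∈ J then F j (z.1 j) else α j :=
          Finset.prod_congr rfl fun j hj => by
            simp [Finset.mem_insert, (Finset.mem_erase.1 hj).1]
        rw [e1, e2]
        simp [hG, hi, sub_mul]
      rw [Finset.card_insert_of_notMem hi]
      push_cast
      have := (abs_le.1 h1).1
      linarith
  simpa using key Finset.univ

lemma finrank_solutions : Module.finrank (ZMod 2) (solutions M (ZMod 2)) = k - M.rank := by
  have h : solutions M (ZMod 2) = LinearMap.ker M.mulVecLin := by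
    ext x
    simp only [mem_solutions, LinearMap.mem_ker, Matrix.mulVecLin_apply, funext_iff, smul_eq_mul]
    rfl
  have h1 := LinearMap.finrank_range_add_finrank_ker M.mulVecLin
  rw [Module.finrank_fin_fun] at h1
  rw [h, Matrix.rank]
  omega

variable (M W) in
omit [Fintype W] in
/-- The solution space is a power of `W`, the exponent being the dimension of the kernel of `M`;
the entries of a solution are linear combinations of its parameters. -/
lemma exists_solutions_param :
    ∃ e : (Fin (k - M.rank) → W) ≃ solutions M W,
      ∀ p j, (e p).1 j ∈ Submodule.span (ZMod 2) (Set.range p) := by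
  classical
  let b := Module.finBasisOfFinrankEq (ZMod 2) (solutions M (ZMod 2)) finrank_solutions
  -- The coordinates on the kernel of `M`, extended to linear forms on the whole space.
  choose β hβ using fun a => LinearMap.exists_extend (b.coord a)
  let Φ : (Fin (k - M.rank) → W) → Fin k → W := fun p j => ∑ a, (b a).1 j • p a
  have hΦ : ∀ p, Φ p ∈ solutions M W := fun p => by
    have : Φ p = ∑ a, fun j => (b a).1 j • p a := by
      funext j
      simp [Φ, Finset.sum_apply]
    rw [this]
    exact sum_mem fun a _ => smul_mem_solutions (b a).2 _
  have hbij : Function.Bijective fun p => (⟨Φ p, hΦ p⟩ : solutions M W) := by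
    constructor
    · intro p q hpq
      have h1 : ∀ j, ∑ a, (b a).1 j • p a = ∑ a, (b a).1 j • q a := fun j =>
        congrFun (congrArg Subtype.val hpq) j
      funext a
      rw [← sub_eq_zero, ← Module.forall_dual_apply_eq_zero_iff (ZMod 2)]
      intro l
      have h2 : ∑ a, l (p a - q a) • b a = 0 := by
        ext j
        have := congrArg l (sub_eq_zero.2 (h1 j))
        rw [← Finset.sum_sub_distrib] at this
        simp only [← smul_sub, map_sum, map_smul, map_zero, smul_eq_mul] at this
        refine Eq.trans ?_ this
        simp [mul_comm]
      exact Fintype.linearIndependent_iff.1 b.linearIndependent _ h2 a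
    · rintro ⟨x, hx⟩
      refine ⟨fun a => ∑ i, β a (Pi.single i 1) • x i, Subtype.ext (funext fun j => ?_)⟩
      rw [← sub_eq_zero, ← Module.forall_dual_apply_eq_zero_iff (ZMod 2)]
      intro l
      have hlx : (fun i => l (x i)) ∈ solutions M (ZMod 2) := map_mem_solutions hx l
      have h2 : ∀ a, ∑ i, β a (Pi.single i 1) * l (x i) = b.coord a ⟨_, hlx⟩ := fun a => by
        rw [← hβ a, LinearMap.comp_apply, Submodule.subtype_apply,
          LinearMap.pi_apply_eq_sum_univ (β a)]
        refine Finset.sum_congr rfl fun i _ => ?_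
        rw [smul_eq_mul, mul_comm]
        congr 2
        funext j
        simp [Pi.single_apply, eq_comm]
      have h3 := congrFun (congrArg Subtype.val (b.sum_repr ⟨_, hlx⟩)) j
      simp only [Φ, map_sub, map_sum, map_smul, smul_eq_mul, h2, Module.Basis.coord_apply]
      simp only [Submodule.coe_sum, Finset.sum_apply, Submodule.coe_smul, Pi.smul_apply,
        smul_eq_mul] at h3
      rw [sub_eq_zero, ← h3]
      exact Finset.sum_congr rfl fun a _ => mul_comm _ _
  refine ⟨Equiv.ofBijective _ hbij, fun p j => ?_⟩
  change Φ p j ∈ _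
  exact Submodule.sum_mem _ fun a _ =>
    Submodule.smul_mem _ _ (Submodule.subset_span (Set.mem_range_self a))

lemma card_solutions : Fintype.card (solutions M W) = Fintype.card W ^ (k - M.rank) := by
  obtain ⟨e, -⟩ := exists_solutions_param M W
  simpa using (Fintype.card_congr e).symm

end Systems

/-! ### Regularity with respect to subspaces -/

section Regularity

variable {V : Type*} [AddCommGroup V] [Module (ZMod 2) V] [Fintype V]

/-- The average of `f` over the coset `x + H`. -/
noncomputable def cosetMean (f : V → ℝ) (H : Submodule (ZMod 2) V) (x : V) : ℝ :=
  𝔼 h : H, f (x + h)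

/-- The energy of `f` relative to the partition of `V` into cosets of `H`. -/
noncomputable def energy (f : V → ℝ) (H : Submodule (ZMod 2) V) : ℝ :=
  𝔼 x, cosetMean f H x ^ 2

/-- The set of points whose coset of `H` is not `η`-uniform for `f`. -/
def irregularSet (η : ℝ) (f : V → ℝ) (H : Submodule (ZMod 2) V) : Set V :=
  {x | ¬ IsUniform η fun h : H => f (x + h)}

/-- The proportion of the cosets of `H` on which `f` is not `η`-uniform. -/
noncomputable def irregularity (η : ℝ) (f : V → ℝ) (H : Submodule (ZMod 2) V) : ℝ :=
  𝔼 x, (irregularSet η f H).indicator 1 x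

lemma expect_expect_coset (H : Submodule (ZMod 2) V) (F : V → ℝ) :
    𝔼 x, 𝔼 h : H, F (x + h) = 𝔼 x, F x := by
  rw [Finset.expect_comm]
  have : ∀ h : H, 𝔼 x, F (x + h) = 𝔼 x, F x := fun h => by
    simpa only [add_comm] using expect_translate F (h : V)
  simp only [this, Fintype.expect_const]

lemma cosetMean_add (f : V → ℝ) (H : Submodule (ZMod 2) V) (x : V) {h : V} (hh : h ∈ H) :
    cosetMean f H (x + h) = cosetMean f H x := by
  have := expect_translate (fun t : H => f (x + t)) ⟨h, hh⟩
  simpa only [cosetMean, add_assoc, Submodule.coe_add] using this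

lemma cosetMean_nonneg {f : V → ℝ} (hf : ∀ x, 0 ≤ f x) (H : Submodule (ZMod 2) V) (x : V) :
    0 ≤ cosetMean f H x := Finset.expect_nonneg fun _ _ => hf _

lemma cosetMean_le_one {f : V → ℝ} (hf : ∀ x, f x ≤ 1) (H : Submodule (ZMod 2) V) (x : V) :
    cosetMean f H x ≤ 1 := Finset.expect_le Finset.univ_nonempty fun _ _ => hf _

lemma energy_nonneg (f : V → ℝ) (H : Submodule (ZMod 2) V) : 0 ≤ energy f H :=
  Finset.expect_nonneg fun _ _ => sq_nonneg _

lemma energy_le_one {f : V → ℝ} (hf₀ : ∀ x, 0 ≤ f x) (hf₁ : ∀ x, f x ≤ 1)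
    (H : Submodule (ZMod 2) V) : energy f H ≤ 1 :=
  Finset.expect_le Finset.univ_nonempty fun x _ =>
    pow_le_one₀ (cosetMean_nonneg hf₀ H x) (cosetMean_le_one hf₁ H x)

lemma expect_cosetMean_mul (f : V → ℝ) (H : Submodule (ZMod 2) V) {φ : V → ℝ}
    (hφ : ∀ x, ∀ h ∈ H, φ (x + h) = φ x) :
    𝔼 x, cosetMean f H x * φ x = 𝔼 x, f x * φ x := by
  rw [← expect_expect_coset H fun x => f x * φ x]
  refine Finset.expect_congr rfl fun x _ => ?_
  rw [cosetMean, Finset.expect_mul]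
  exact Finset.expect_congr rfl fun h _ => by rw [hφ x h h.2]

/-- Refining the partition increases the energy by the mean square of the change of the averages. -/
lemma expect_cosetMean_sub_sq (f : V → ℝ) {H H' : Submodule (ZMod 2) V} (hle : H' ≤ H) :
    𝔼 x, (cosetMean f H' x - cosetMean f H x) ^ 2 = energy f H' - energy f H := by
  have h1 : ∀ x, (cosetMean f H' x - cosetMean f H x) ^ 2 = cosetMean f H' x ^ 2
      - 2 * (cosetMean f H' x * cosetMean f H x) + cosetMean f H x * cosetMean f H x :=
    fun x => by ring
  simp only [h1, Finset.expect_add_distrib, Finset.expect_sub_distrib, ← Finset.mul_expect]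
  rw [expect_cosetMean_mul f H' fun x h hh => cosetMean_add f H x (hle hh),
    ← expect_cosetMean_mul f H fun x h hh => cosetMean_add f H x hh]
  simp only [energy, pow_two]
  ring

lemma walsh_sq_le {W : Type*} [AddCommGroup W] [Module (ZMod 2) W] [Fintype W] (F : W → ℝ)
    (l : Module.Dual (ZMod 2) W) : walsh F l ^ 2 ≤ 𝔼 x, F x ^ 2 := by
  have h := Finset.expect_mul_sq_le_sq_mul_sq Finset.univ F fun x => sgn (l x)
  simpa [pow_two, sgn_mul_self, walsh] using h

/-- If `f` is not uniform on too many cosets of `H`, the subspace cut out by the offending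
characters has larger energy. -/
lemma exists_energy_increment {η : ℝ} (hη : 0 < η) (f : V → ℝ) (H : Submodule (ZMod 2) V)
    (hirr : η < irregularity η f H) :
    ∃ H' ≤ H, Module.finrank (ZMod 2) (V ⧸ H') ≤
        Module.finrank (ZMod 2) (V ⧸ H) + 2 ^ Module.finrank (ZMod 2) (V ⧸ H) ∧
      energy f H + η ^ 3 ≤ energy f H' := by
  have hchoice : ∀ q : V ⧸ H, ∃ l : Module.Dual (ZMod 2) H, ∀ x : V, H.mkQ x = q →
      ¬ IsUniform η (fun h : H => f (x + h)) →
      l ≠ 0 ∧ η < |walsh (fun h : H => f (x + h)) l| := by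
    intro q
    by_cases hq : ∃ x : V, H.mkQ x = q ∧ x ∈ irregularSet η f H
    · obtain ⟨x, hx, hb⟩ := hq
      simp only [irregularSet, Set.mem_ofPred_eq, IsUniform, not_forall, not_le] at hb
      obtain ⟨l, hl, hb⟩ := hb
      refine ⟨l, fun y hy _ => ⟨hl, ?_⟩⟩
      have hyx : y - x ∈ H := by
        rw [← Submodule.Quotient.mk_eq_zero, Submodule.Quotient.mk_sub, sub_eq_zero]
        exact hy.trans hx.symm
      have h1 : (fun h : H => f (y + h)) = fun h : H => f (x + ((⟨y - x, hyx⟩ + h : H) : V)) := by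
        funext h
        congr 1
        simp only [Submodule.coe_add]
        abel
      rw [h1, walsh_translate (fun h : H => f (x + h)), abs_mul, abs_sgn, one_mul]
      exact hb
    · exact ⟨0, fun x hx hb => (hq ⟨x, hx, hb⟩).elim⟩
  choose l hl using hchoice
  choose g hg using fun q => LinearMap.exists_extend (l q)
  set Φ : V →ₗ[ZMod 2] (V ⧸ H) × (V ⧸ H → ZMod 2) := H.mkQ.prod (LinearMap.pi g) with hΦ
  have hmem : ∀ x ∈ LinearMap.ker Φ, x ∈ H ∧ ∀ q, g q x = 0 := by
    intro x hx
    rw [LinearMap.mem_ker, hΦ, LinearMap.prod_apply, Function.prod_apply, Prod.mk_eq_zero] at hx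
    exact ⟨by simpa using hx.1, fun q => congrFun hx.2 q⟩
  have hle : LinearMap.ker Φ ≤ H := fun x hx => (hmem x hx).1
  refine ⟨LinearMap.ker Φ, hle, ?_, ?_⟩
  · rw [Φ.quotKerEquivRange.finrank_eq]
    refine (Submodule.finrank_le _).trans ?_
    rw [Module.finrank_prod, Module.finrank_pi, Module.card_eq_pow_finrank (K := ZMod 2),
      ZMod.card]
  set H' := LinearMap.ker Φ with hH'
  have key : ∀ x, ¬ IsUniform η (fun h : H => f (x + h)) →
      η ^ 2 ≤ 𝔼 h : H, (cosetMean f H' (x + h) - cosetMean f H (x + h)) ^ 2 := by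
    intro x hx
    obtain ⟨hl0, hlx⟩ := hl (H.mkQ x) x rfl hx
    set L := l (H.mkQ x) with hL
    have h1 : walsh (fun h : H => cosetMean f H' (x + h) - cosetMean f H (x + h)) L
        = walsh (fun h : H => f (x + h)) L := by
      have h2 : (fun h : H => cosetMean f H' (x + h) - cosetMean f H (x + h))
          = fun h : H => cosetMean f H' (x + h) - cosetMean f H x := by
        funext h; rw [cosetMean_add f H x h.2]
      rw [h2, walsh_sub, walsh_const _ hl0, sub_zero]
      -- Averaging over cosets of `H'` does not change the coefficient, as `L` vanishes on `H'`.
      have h3 : ∀ t : H', 𝔼 h : H, f (x + h + t) * sgn (L h)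
          = walsh (fun h : H => f (x + h)) L := by
        intro t
        have h4 := walsh_translate (fun h : H => f (x + h)) L ⟨t, hle t.2⟩
        have h5 : L ⟨t, hle t.2⟩ = 0 := by
          rw [hL, ← hg]
          exact (hmem t t.2).2 _
        rw [h5, sgn_zero, one_mul] at h4
        rw [← h4]
        refine Finset.expect_congr rfl fun h _ => ?_
        congr 2
        simp only [Submodule.coe_add]
        abel
      simp only [walsh, cosetMean, Finset.expect_mul]
      rw [Finset.expect_comm]
      simp only [h3, Fintype.expect_const]
      rfl
    calc η ^ 2 ≤ |walsh (fun h : H => f (x + h)) L| ^ 2 := by gcongr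
      _ = walsh (fun h : H => cosetMean f H' (x + h) - cosetMean f H (x + h)) L ^ 2 := by
        rw [h1, sq_abs]
      _ ≤ _ := walsh_sq_le _ _
  have h6 : irregularity η f H * η ^ 2 ≤ energy f H' - energy f H := by
    rw [← expect_cosetMean_sub_sq f hle,
      ← expect_expect_coset H fun x => (cosetMean f H' x - cosetMean f H x) ^ 2, irregularity,
      Finset.expect_mul]
    refine Finset.expect_le_expect fun x _ => ?_
    by_cases hx : x ∈ irregularSet η f H
    · rw [Set.indicator_of_mem hx, Pi.one_apply, one_mul]
      exact key x hx
    · rw [Set.indicator_of_notMem hx, zero_mul]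
      exact Finset.expect_nonneg fun _ _ => sq_nonneg _
  nlinarith [mul_le_mul_of_nonneg_right hirr.le (sq_nonneg η)]

end Regularity

/-- The regularity lemma: every subspace contains one of bounded codimension such that `f` is
uniform on almost all of its cosets. -/
lemma exists_regular_subspace {η : ℝ} (hη : 0 < η) :
    ∃ T : ℕ → ℕ, Monotone T ∧ ∀ (V : Type) [AddCommGroup V] [Module (ZMod 2) V] [Fintype V]
      (f : V → ℝ), (∀ x, 0 ≤ f x) → (∀ x, f x ≤ 1) → ∀ H : Submodule (ZMod 2) V,
      ∃ H' ≤ H, Module.finrank (ZMod 2) (V ⧸ H') ≤ T (Module.finrank (ZMod 2) (V ⧸ H)) ∧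
        irregularity η f H' ≤ η := by
  have key : ∀ j : ℕ, ∃ T : ℕ → ℕ, Monotone T ∧
      ∀ (V : Type) [AddCommGroup V] [Module (ZMod 2) V] [Fintype V]
      (f : V → ℝ), (∀ x, 0 ≤ f x) → (∀ x, f x ≤ 1) → ∀ H : Submodule (ZMod 2) V,
      1 - j * η ^ 3 < energy f H →
      ∃ H' ≤ H, Module.finrank (ZMod 2) (V ⧸ H') ≤ T (Module.finrank (ZMod 2) (V ⧸ H)) ∧
        irregularity η f H' ≤ η := by
    intro j
    induction j with
    | zero =>
      refine ⟨id, monotone_id, fun V _ _ _ f hf₀ hf₁ H hH => ?_⟩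
      have := energy_le_one hf₀ hf₁ H
      simp only [Nat.cast_zero, zero_mul, sub_zero] at hH
      linarith
    | succ j ih =>
      obtain ⟨T, hT, ih⟩ := ih
      refine ⟨fun c => T (c + 2 ^ c) + c, fun a b hab => ?_, fun V _ _ _ f hf₀ hf₁ H hH => ?_⟩
      · have : 2 ^ a ≤ 2 ^ b := Nat.pow_le_pow_right (by norm_num) hab
        exact add_le_add (hT (by omega)) hab
      by_cases hirr : irregularity η f H ≤ η
      · exact ⟨H, le_rfl, Nat.le_add_left _ _, hirr⟩
      obtain ⟨H₁, hle, hcodim, hen⟩ := exists_energy_increment hη f H (not_le.1 hirr)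
      push_cast at hH
      obtain ⟨H', hle', hcodim', hirr'⟩ := ih V f hf₀ hf₁ H₁ (by linarith)
      exact ⟨H', hle'.trans hle, (hcodim'.trans (hT hcodim)).trans (Nat.le_add_right _ _), hirr'⟩
  obtain ⟨j, hj⟩ := exists_nat_gt (1 / η ^ 3)
  obtain ⟨T, hT, h⟩ := key j
  refine ⟨T, hT, fun V _ _ _ f hf₀ hf₁ H => h V f hf₀ hf₁ H ?_⟩
  have h3 : 0 < η ^ 3 := by positivity
  rw [div_lt_iff₀ h3] at hj
  linarith [energy_nonneg f H]

/-- The strong regularity lemma: there are subspaces `H' ≤ H` such that `f` is uniform on almost all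
cosets of `H'`, to a degree depending on the codimension of `H`, and such that most averages over
cosets of `H'` are close to those over the cosets of `H` that contain them. -/
lemma exists_strongly_regular_pair (c : ℕ) {ε : ℝ} (hε : 0 < ε) (η : ℕ → ℝ) (hη : ∀ r, 0 < η r) :
    ∃ R : ℕ, ∀ (V : Type) [AddCommGroup V] [Module (ZMod 2) V] [Fintype V]
      (f : V → ℝ), (∀ x, 0 ≤ f x) → (∀ x, f x ≤ 1) → ∀ H₀ : Submodule (ZMod 2) V,
      Module.finrank (ZMod 2) (V ⧸ H₀) = c →
      ∃ H ≤ H₀, ∃ H' ≤ H, Module.finrank (ZMod 2) (V ⧸ H') ≤ R ∧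
        irregularity (η (Module.finrank (ZMod 2) (V ⧸ H))) f H' ≤
          η (Module.finrank (ZMod 2) (V ⧸ H)) ∧
        energy f H' - energy f H ≤ ε := by
  choose T hT hreg using fun r => exists_regular_subspace (hη r)
  have key : ∀ (j c : ℕ), ∃ R : ℕ, ∀ (V : Type) [AddCommGroup V] [Module (ZMod 2) V] [Fintype V]
      (f : V → ℝ), (∀ x, 0 ≤ f x) → (∀ x, f x ≤ 1) → ∀ H₀ : Submodule (ZMod 2) V,
      Module.finrank (ZMod 2) (V ⧸ H₀) ≤ c → 1 - j * ε < energy f H₀ →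
      ∃ H ≤ H₀, ∃ H' ≤ H, Module.finrank (ZMod 2) (V ⧸ H') ≤ R ∧
        irregularity (η (Module.finrank (ZMod 2) (V ⧸ H))) f H' ≤
          η (Module.finrank (ZMod 2) (V ⧸ H)) ∧
        energy f H' - energy f H ≤ ε := by
    intro j
    induction j with
    | zero =>
      refine fun c => ⟨0, fun V _ _ _ f hf₀ hf₁ H _ hH => ?_⟩
      have := energy_le_one hf₀ hf₁ H
      simp only [Nat.cast_zero, zero_mul, sub_zero] at hH
      linarith
    | succ j ih =>
      intro c
      set c' := ∑ r ∈ Finset.range (c + 1), T r r with hc'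
      obtain ⟨R, hR⟩ := ih c'
      refine ⟨R + c', fun V _ _ _ f hf₀ hf₁ H hHc hH => ?_⟩
      obtain ⟨H', hle, hcodim, hirr⟩ := hreg (Module.finrank (ZMod 2) (V ⧸ H)) V f hf₀ hf₁ H
      have hcodim' : Module.finrank (ZMod 2) (V ⧸ H') ≤ c' :=
        hcodim.trans (Finset.single_le_sum (f := fun r => T r r) (fun _ _ => Nat.zero_le _)
          (Finset.mem_range.2 (by omega)))
      by_cases hen : energy f H' - energy f H ≤ ε
      · exact ⟨H, le_rfl, H', hle, hcodim'.trans (Nat.le_add_left _ _), hirr, hen⟩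
      push_cast at hH
      obtain ⟨H₁, hle₁, H₂, hle₂, h₂, h₃, h₄⟩ := hR V f hf₀ hf₁ H' hcodim' (by linarith)
      exact ⟨H₁, hle₁.trans hle, H₂, hle₂, h₂.trans (Nat.le_add_right _ _), h₃, h₄⟩
  obtain ⟨j, hj⟩ := exists_nat_gt (1 / ε)
  obtain ⟨R, hR⟩ := key j c
  refine ⟨R, fun V _ _ _ f hf₀ hf₁ H hH => hR V f hf₀ hf₁ H hH.le ?_⟩
  rw [div_lt_iff₀ hε] at hj
  linarith [energy_nonneg f H]

/-! ### A Ramsey theorem for vector spaces -/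

/-- Every 2-colouring of a vector space of large dimension is constant on an affine subspace
of given dimension that does not contain the origin. -/
lemma exists_mono_affine (κ : Type) [Finite κ] :
    ∃ (ι : Type) (_ : Finite ι), ∀ C : (ι → ZMod 2) → Bool,
      ∃ (a : ι → ZMod 2) (ψ : (κ → ZMod 2) →ₗ[ZMod 2] (ι → ZMod 2)) (c : Bool),
        Function.Injective ψ ∧ ∀ z, a + ψ z ≠ 0 ∧ C (a + ψ z) = c := by
  obtain ⟨ι, _, h⟩ := Combinatorics.Subspace.exists_mono_in_high_dimension (ZMod 2) Bool κ
  -- An additional coordinate, equal to one, keeps the affine subspace away from the origin.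
  refine ⟨Option ι, inferInstance, fun C => ?_⟩
  obtain ⟨l, c, hl⟩ := h fun y => C fun o => o.elim 1 y
  let ψ : (κ → ZMod 2) →ₗ[ZMod 2] (Option ι → ZMod 2) :=
    { toFun := fun x o => o.elim 0 fun i => (l.idxFun i).elim (fun _ => 0) x
      map_add' := fun x y => by
        funext o
        rcases o with _ | i
        · simp
        · rcases hi : l.idxFun i with _ | e <;> simp [hi]
      map_smul' := fun t x => by
        funext o
        rcases o with _ | i
        · simp
        · rcases hi : l.idxFun i with _ | e <;> simp [hi] }
  refine ⟨fun o => o.elim 1 fun i => (l.idxFun i).elim id fun _ => 0, ψ, c, ?_, fun z => ⟨?_, ?_⟩⟩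
  · intro x y hxy
    funext e
    obtain ⟨i, hi⟩ := l.proper e
    have := congrFun hxy (some i)
    simpa [ψ, hi] using this
  · intro h0
    have := congrFun h0 none
    simp [ψ] at this
  · rw [← hl z]
    congr 1
    funext o
    rcases o with _ | i
    · simp [ψ]
    · rcases hi : l.idxFun i with _ | e <;> simp [ψ, hi, Combinatorics.Subspace.coe_apply]

/-- Every 2-colouring of a vector space of large dimension is constant on the nonzero vectors
of a subspace of given dimension. -/
lemma exists_mono_subspace (m : ℕ) :
    ∃ (ι : Type) (_ : Finite ι), ∀ C : (ι → ZMod 2) → Bool,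
      ∃ (ψ : (Fin m → ZMod 2) →ₗ[ZMod 2] (ι → ZMod 2)) (c : Bool),
        ∀ z ≠ 0, ψ z ≠ 0 ∧ C (ψ z) = c := by
  -- The asymmetric statement, with different dimensions for the two colours, allows an induction on
  -- the sum of the two dimensions.
  have key : ∀ s : ℕ, ∃ (ι : Type) (_ : Finite ι), ∀ p : Bool → ℕ, p true + p false = s →
      ∀ C : (ι → ZMod 2) → Bool,
      ∃ (c : Bool) (d : ℕ), p c = d ∧ ∃ ψ : (Fin d → ZMod 2) →ₗ[ZMod 2] (ι → ZMod 2),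
        ∀ z ≠ 0, ψ z ≠ 0 ∧ C (ψ z) = c := by
    intro s
    induction s with
    | zero =>
      refine ⟨Empty, inferInstance, fun p hp C => ⟨true, 0, by omega, 0, fun z hz => ?_⟩⟩
      exact (hz (Subsingleton.elim _ _)).elim
    | succ s ih =>
      obtain ⟨κ, _, ih⟩ := ih
      obtain ⟨ι, hι, h⟩ := exists_mono_affine κ
      refine ⟨ι, hι, fun p hp C => ?_⟩
      obtain ⟨a, θ, c, hθ, hc⟩ := h C
      have hθ0 : ∀ y, y ≠ 0 → θ y ≠ 0 := fun y hy => (map_ne_zero_iff θ hθ).2 hy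
      rcases hr : p c with _ | r
      · exact ⟨c, 0, hr, 0, fun z hz => (hz (Subsingleton.elim _ _)).elim⟩
      obtain ⟨c', d, hd, ψ, hψ⟩ := ih (Function.update p c r) (by
        cases c <;> simp_all <;> omega) fun y => C (θ y)
      by_cases hcc : c' = c
      · subst hcc
        rw [Function.update_self] at hd
        subst hd
        -- The translate `a` of the affine subspace provides the additional dimension.
        refine ⟨c', r + 1, hr, (LinearMap.proj 0).smulRight a +
          θ ∘ₗ ψ ∘ₗ LinearMap.funLeft (ZMod 2) (ZMod 2) Fin.succ, fun z hz => ?_⟩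
        rcases zmod_two_eq_zero_or_one (z 0) with h0 | h0
        · have hz' : LinearMap.funLeft (ZMod 2) (ZMod 2) Fin.succ z ≠ 0 := by
            intro h1
            refine hz (funext fun i => ?_)
            refine Fin.cases h0 (fun j => ?_) i
            exact congrFun h1 j
          obtain ⟨h2, h3⟩ := hψ _ hz'
          simpa [h0] using ⟨hθ0 _ h2, h3⟩
        · simpa [h0] using hc (ψ (LinearMap.funLeft (ZMod 2) (ZMod 2) Fin.succ z))
      · rw [Function.update_of_ne hcc] at hd
        exact ⟨c', d, hd, θ ∘ₗ ψ, fun z hz => ⟨hθ0 _ (hψ z hz).1, (hψ z hz).2⟩⟩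
  obtain ⟨ι, hι, h⟩ := key (m + m)
  refine ⟨ι, hι, fun C => ?_⟩
  obtain ⟨c, d, rfl, ψ, hψ⟩ := h (fun _ => m) rfl C
  exact ⟨ψ, c, hψ⟩

/-! ### Random linear maps -/

/-- A random linear map sends every nonzero vector to a uniformly distributed one. -/
lemma exists_linearMap_sum_le {A U : Type*} [AddCommGroup A] [Module (ZMod 2) A] [Finite A]
    [AddCommGroup U] [Module (ZMod 2) U] [Fintype U] (S : Finset A) (hS : 0 ∉ S)
    (w : A → U → ℝ) :
    ∃ τ : A →ₗ[ZMod 2] U, ∑ a ∈ S, w a (τ a) ≤ ∑ a ∈ S, 𝔼 u, w a u := by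
  have h1 : ∀ a ∈ S, 𝔼 τ : A →ₗ[ZMod 2] U, w a (τ a) = 𝔼 u, w a u := by
    intro a ha
    obtain ⟨l, hl⟩ : ∃ l : Module.Dual (ZMod 2) A, l a ≠ 0 := by
      by_contra! h
      exact hS ((Module.forall_dual_apply_eq_zero_iff (ZMod 2) a).1 h ▸ ha)
    have hl1 : l a = 1 := (zmod_two_eq_zero_or_one _).resolve_left hl
    have h2 : ∀ u : U, 𝔼 τ : A →ₗ[ZMod 2] U, w a (τ a) = 𝔼 τ : A →ₗ[ZMod 2] U, w a (u + τ a) := by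
      intro u
      rw [← expect_translate (fun τ : A →ₗ[ZMod 2] U => w a (τ a)) (l.smulRight u)]
      simp [hl1]
    have h3 : ∀ τ : A →ₗ[ZMod 2] U, 𝔼 u, w a (u + τ a) = 𝔼 u, w a u := fun τ => by
      simpa only [add_comm] using expect_translate (w a) (τ a)
    rw [← Fintype.expect_const (ι := U) (𝔼 τ : A →ₗ[ZMod 2] U, w a (τ a))]
    rw [Finset.expect_congr rfl fun u _ => h2 u, Finset.expect_comm]
    simp only [h3, Fintype.expect_const]
  have h4 : 𝔼 τ : A →ₗ[ZMod 2] U, ∑ a ∈ S, w a (τ a) ≤ ∑ a ∈ S, 𝔼 u, w a u := by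
    rw [Finset.expect_sum_comm]
    exact (Finset.sum_congr rfl h1).le
  obtain ⟨τ, -, hτ⟩ := Finset.exists_le_of_expect_le Finset.univ_nonempty h4
  exact ⟨τ, hτ⟩

/-! ### Colour densities -/

section Colours

variable {V : Type*}

/-- The indicator function of the points that `f` colours with `c`. -/
def colourInd (f : V → Bool) (c : Bool) (x : V) : ℝ := if f x = c then 1 else 0

lemma colourInd_nonneg (f : V → Bool) (c : Bool) (x : V) : 0 ≤ colourInd f c x := by
  unfold colourInd; split_ifs <;> norm_num

lemma colourInd_le_one (f : V → Bool) (c : Bool) (x : V) : colourInd f c x ≤ 1 := by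
  unfold colourInd; split_ifs <;> norm_num

lemma colourInd_false (f : V → Bool) (x : V) : colourInd f false x = 1 - colourInd f true x := by
  unfold colourInd; cases f x <;> simp

variable [AddCommGroup V] [Module (ZMod 2) V] [Fintype V]

lemma isUniform_colourInd {η : ℝ} {f : V → Bool} (h : IsUniform η (colourInd f true)) (c : Bool) :
    IsUniform η (colourInd f c) := by
  cases c
  · intro l hl
    have : colourInd f false = fun x => 1 - colourInd f true x := funext (colourInd_false f)
    rw [this, walsh_sub, walsh_const _ hl, zero_sub, abs_neg]
    exact h l hl
  · exact h

lemma cosetMean_colourInd_false (f : V → Bool) (H : Submodule (ZMod 2) V) (x : V) :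
    cosetMean (colourInd f false) H x = 1 - cosetMean (colourInd f true) H x := by
  simp only [cosetMean, colourInd_false, Finset.expect_sub_distrib, Fintype.expect_const]

lemma cosetMean_colourInd_not (f : V → Bool) (H : Submodule (ZMod 2) V) (x : V) (c : Bool) :
    cosetMean (colourInd f !c) H x = 1 - cosetMean (colourInd f c) H x := by
  cases c <;> simp [cosetMean_colourInd_false]

end Colours

/-- In every 2-coloured space of large dimension there are a subspace `H` of bounded codimension and
a family of cosets of `H`, indexed linearly by a space of given dimension, such that, outside the
index zero, the colouring is uniform on them and one colour is the most frequent one. -/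
lemma exists_mono_cosets (m : ℕ) {η : ℝ} (hη : 0 < η) :
    ∃ t : ℕ, ∀ (U : Type) [AddCommGroup U] [Module (ZMod 2) U] [Fintype U] (f : U → Bool),
      ∃ (H : Submodule (ZMod 2) U) (φ : (Fin m → ZMod 2) →ₗ[ZMod 2] U) (c : Bool),
        Module.finrank (ZMod 2) (U ⧸ H) ≤ t ∧
        ∀ z ≠ 0, IsUniform η (fun h : H => colourInd f true (φ z + h)) ∧
          1 / 2 ≤ cosetMean (colourInd f c) H (φ z) := by
  obtain ⟨ι, _, hι⟩ := exists_mono_subspace m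
  obtain ⟨S, hS⟩ : ∃ S : Finset (ι → ZMod 2), ∀ a, a ∈ S ↔ a ≠ 0 := by
    classical exact ⟨Finset.univ.erase 0, by simp⟩
  have hη' : 0 < min η (1 / (S.card + 1)) := lt_min hη (by positivity)
  obtain ⟨T, hT, hreg⟩ := exists_regular_subspace hη'
  refine ⟨T 0, fun U _ _ _ f => ?_⟩
  obtain ⟨H, -, hcodim, hirr⟩ := hreg U (colourInd f true) (colourInd_nonneg f true)
    (colourInd_le_one f true) ⊤
  set η' := min η (1 / (S.card + 1)) with hη'def
  have htop : Module.finrank (ZMod 2) (U ⧸ (⊤ : Submodule (ZMod 2) U)) = 0 :=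
    Module.finrank_zero_of_subsingleton
  rw [htop] at hcodim
  obtain ⟨φ₀, hφ₀⟩ := exists_linearMap_sum_le S (fun h => (hS 0).1 h rfl)
    fun _ u => (irregularSet η' (colourInd f true) H).indicator 1 u
  have hφ₁ : ∀ a ≠ 0, IsUniform η (fun h : H => colourInd f true (φ₀ a + h)) := by
    intro a ha
    suffices h : φ₀ a ∉ irregularSet η' (colourInd f true) H from
      (not_not.1 h).mono (min_le_left _ _)
    intro hbad
    have h1 : (1 : ℝ) ≤ ∑ a ∈ S, (irregularSet η' (colourInd f true) H).indicator 1 (φ₀ a) := by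
      refine le_trans ?_ (Finset.single_le_sum (fun b _ => ?_) ((hS a).2 ha))
      · rw [Set.indicator_of_mem hbad, Pi.one_apply]
      · exact Set.indicator_nonneg (fun _ _ => zero_le_one) _
    have h2 : ∑ a ∈ S, 𝔼 u, (irregularSet η' (colourInd f true) H).indicator (1 : U → ℝ) u
        ≤ S.card * (1 / (S.card + 1)) := by
      rw [Finset.sum_const, nsmul_eq_mul]
      exact mul_le_mul_of_nonneg_left (hirr.trans (min_le_right _ _)) (Nat.cast_nonneg _)
    have h3 : (S.card : ℝ) * (1 / (S.card + 1)) < 1 := by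
      rw [mul_one_div, div_lt_one (by positivity)]
      linarith
    linarith
  obtain ⟨ψ, c, hψ⟩ := hι fun a => decide (1 / 2 ≤ cosetMean (colourInd f true) H (φ₀ a))
  refine ⟨H, φ₀ ∘ₗ ψ, c, hcodim, fun z hz => ⟨hφ₁ _ (hψ z hz).1, ?_⟩⟩
  have h4 := (hψ z hz).2
  cases c
  · rw [decide_eq_false_iff_not, not_le] at h4
    rw [cosetMean_colourInd_false]
    exact le_trans (by norm_num) (sub_le_sub_left h4.le 1)
  · exact of_decide_eq_true h4

/-! ### The induced removal lemma -/

section Removal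

variable {V : Type*} [AddCommGroup V] [Module (ZMod 2) V] [Fintype V]

/-- Averaging over the space amounts to averaging over all cosets, represented by a section. -/
lemma expect_section (H : Submodule (ZMod 2) V) {s : V ⧸ H → V} (hs : ∀ u, H.mkQ (s u) = u)
    (w : V → ℝ) : 𝔼 u : V ⧸ H, 𝔼 h : H, w (s u + h) = 𝔼 x, w x := by
  have hbij : Function.Bijective fun p : (V ⧸ H) × H => s p.1 + p.2 := by
    constructor
    · rintro ⟨u, h⟩ ⟨u', h'⟩ heq
      have h1 : u = u' := by
        have := congrArg H.mkQ heq
        simpa only [map_add, hs, Submodule.mkQ_apply,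
          (Submodule.Quotient.mk_eq_zero H).2 (Subtype.prop _), add_zero] using this
      subst h1
      simpa using heq
    · intro x
      have hx : x - s (H.mkQ x) ∈ H := by
        rw [← Submodule.Quotient.mk_eq_zero, Submodule.Quotient.mk_sub, sub_eq_zero]
        exact (hs _).symm
      exact ⟨(H.mkQ x, ⟨_, hx⟩), by simp⟩
  rw [← Fintype.expect_equiv (Equiv.ofBijective _ hbij) (fun p => w (s p.1 + p.2)) w fun _ => rfl,
    ← Finset.univ_product_univ]
  exact (Finset.expect_product' _ _ fun (u : V ⧸ H) (h : H) => w (s u + h)).symm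

/-- A random linear section of `V → V ⧸ H` picks, for every nonzero class, a representative whose
coset of `H'` is uniform and has, in the mean, almost the same average as the class. -/
lemma exists_good_section (f : V → ℝ) {H H' : Submodule (ZMod 2) V} (hle : H' ≤ H) {η ε : ℝ}
    (hε : 0 < ε) (hη : η * Fintype.card (V ⧸ H) ≤ 1 / 4) (hirr : irregularity η f H' ≤ η)
    (hen : energy f H' - energy f H ≤ ε) {S : Finset (V ⧸ H)} (hS : ∀ u, u ∈ S ↔ u ≠ 0) :
    ∃ s : V ⧸ H →ₗ[ZMod 2] V, (∀ u, H.mkQ (s u) = u) ∧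
      (∀ u ≠ 0, IsUniform η fun h : H' => f (s u + h)) ∧
      ∑ u ∈ S, (cosetMean f H' (s u) - cosetMean f H (s u)) ^ 2
        ≤ 2 * ε * Fintype.card (V ⧸ H) := by
  obtain ⟨s₀, hs₀⟩ := H.mkQ.exists_rightInverse_of_surjective
    (LinearMap.range_eq_top.2 H.mkQ_surjective)
  have hs₀' : ∀ u, H.mkQ (s₀ u) = u := fun u => LinearMap.congr_fun hs₀ u
  set C : ℝ := (Fintype.card (V ⧸ H) : ℝ) with hC
  have hC0 : 0 < C := Nat.cast_pos.2 Fintype.card_pos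
  set l : ℝ := 1 / (2 * ε * C) with hl
  have hl0 : 0 < l := by positivity
  -- A single weight measures both defects.
  set w : V → ℝ := fun x => (irregularSet η f H').indicator 1 x +
    l * (cosetMean f H' x - cosetMean f H x) ^ 2 with hw
  have hind : ∀ x, 0 ≤ (irregularSet η f H').indicator (1 : V → ℝ) x := fun x =>
    Set.indicator_nonneg (fun _ _ => zero_le_one) _
  have hsq : ∀ x, 0 ≤ l * (cosetMean f H' x - cosetMean f H x) ^ 2 := fun x => by positivity
  have hw0 : ∀ x, 0 ≤ w x := fun x => add_nonneg (hind x) (hsq x)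
  have hEw : 𝔼 x, w x ≤ η + l * ε := by
    rw [hw, Finset.expect_add_distrib, ← Finset.mul_expect, expect_cosetMean_sub_sq f hle]
    exact add_le_add hirr (mul_le_mul_of_nonneg_left hen hl0.le)
  obtain ⟨τ, hτ⟩ := exists_linearMap_sum_le S (fun h => (hS 0).1 h rfl)
    fun u (h : H) => w (s₀ u + h)
  have hsum : ∑ u ∈ S, w (s₀ u + τ u) < 1 := by
    have h1 : ∑ u ∈ S, 𝔼 h : H, w (s₀ u + h) ≤ ∑ u, 𝔼 h : H, w (s₀ u + h) :=
      Finset.sum_le_sum_of_subset_of_nonneg (Finset.subset_univ _) fun u _ _ =>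
        Finset.expect_nonneg fun h _ => hw0 _
    have h2 : ∑ u, 𝔼 h : H, w (s₀ u + h) = C * 𝔼 x, w x := by
      rw [← expect_section H hs₀' w, hC, Fintype.card_mul_expect]
    have h3 : C * 𝔼 x, w x ≤ C * (η + l * ε) := mul_le_mul_of_nonneg_left hEw hC0.le
    have h4 : C * (l * ε) = 1 / 2 := by rw [hl]; field_simp
    nlinarith
  refine ⟨s₀ + H.subtype ∘ₗ τ, fun u => ?_, fun u hu => ?_, ?_⟩
  · simp only [LinearMap.add_apply, LinearMap.comp_apply, Submodule.subtype_apply, map_add, hs₀']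
    rw [Submodule.mkQ_apply, (Submodule.Quotient.mk_eq_zero H).2 (τ u).2, add_zero]
  · by_contra hbad
    have h1 : w (s₀ u + τ u) ≤ ∑ u ∈ S, w (s₀ u + τ u) :=
      Finset.single_le_sum (f := fun u => w (s₀ u + τ u)) (fun b _ => hw0 _) ((hS u).2 hu)
    have h2 : (irregularSet η f H').indicator (1 : V → ℝ) (s₀ u + τ u) = 1 :=
      Set.indicator_of_mem (a := s₀ u + τ u) hbad _
    have h3 := hsq (s₀ u + τ u)
    have h4 : w (s₀ u + τ u) = (irregularSet η f H').indicator 1 (s₀ u + τ u) +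
      l * (cosetMean f H' (s₀ u + τ u) - cosetMean f H (s₀ u + τ u)) ^ 2 := rfl
    linarith
  · have h1 : l * ∑ u ∈ S, (cosetMean f H' (s₀ u + τ u) - cosetMean f H (s₀ u + τ u)) ^ 2
        ≤ ∑ u ∈ S, w (s₀ u + τ u) := by
      rw [Finset.mul_sum]
      exact Finset.sum_le_sum fun u _ => le_add_of_nonneg_left (hind _)
    have h2 : ∑ u ∈ S, (cosetMean f H' (s₀ u + τ u) - cosetMean f H (s₀ u + τ u)) ^ 2 ≤ 1 / l := by
      rw [le_div_iff₀ hl0]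
      linarith
    rw [hl, one_div_one_div] at h2
    exact h2

/-- Recolour `f` so that `H` is monochromatic and outside `H` only those colours remain that are
frequent on the coset of `H'` representing the class of the point. Few values change. -/
lemma exists_recolouring (f : V → Bool) (H H' : Submodule (ZMod 2) V) (c : Bool) {α : ℝ}
    (hα : 0 < α) (hα' : α ≤ 1 / 2) {s : V ⧸ H → V} (hs : ∀ u, H.mkQ (s u) = u)
    {S : Finset (V ⧸ H)} (hS : ∀ u, u ∈ S ↔ u ≠ 0) :
    ∃ g : V → Bool, (∀ x, H.mkQ x = 0 → g x = c) ∧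
      (∀ x, H.mkQ x ≠ 0 → α ≤ cosetMean (colourInd f (g x)) H' (s (H.mkQ x))) ∧
      (hammingDist f g : ℝ) ≤ Fintype.card V * (1 / Fintype.card (V ⧸ H) + 4 * α +
        2 / α * ((∑ u ∈ S, (cosetMean (colourInd f true) H' (s u) -
          cosetMean (colourInd f true) H (s u)) ^ 2) / Fintype.card (V ⧸ H))) := by
  let _ : DecidableEq (V ⧸ H) := Classical.decEq _
  set dens : V ⧸ H → Bool → ℝ := fun u b => cosetMean (colourInd f b) H' (s u) with hdens
  have hnot : ∀ u b, dens u (!b) = 1 - dens u b := fun u b => cosetMean_colourInd_not f H' _ b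
  set g : V → Bool := fun x => if H.mkQ x = 0 then c else
    if α ≤ dens (H.mkQ x) (f x) then f x else !(f x) with hg
  refine ⟨g, fun x hx => by simp only [hg, if_pos hx], fun x hx => ?_, ?_⟩
  · change α ≤ dens (H.mkQ x) (g x)
    simp only [hg, if_neg hx]
    split_ifs with h1
    · exact h1
    · rw [hnot]
      linarith
  set diff : V ⧸ H → ℝ := fun u => cosetMean (colourInd f true) H' (s u) -
    cosetMean (colourInd f true) H (s u) with hdiff
  have hcard : (hammingDist f g : ℝ) = Fintype.card V * 𝔼 x, if f x ≠ g x then (1 : ℝ) else 0 := by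
    rw [Fintype.card_mul_expect, Finset.sum_boole, hammingDist]
  rw [hcard]
  refine mul_le_mul_of_nonneg_left ?_ (Nat.cast_nonneg _)
  rw [← expect_section H hs]
  have hmk : ∀ u (h : H), H.mkQ (s u + h) = u := fun u h => by
    rw [map_add, hs, Submodule.mkQ_apply _ (h : V), (Submodule.Quotient.mk_eq_zero H).2 h.2,
      add_zero]
  -- A colour that is rare on the representing coset is rare on the whole class.
  have hrare : ∀ u b, dens u b < α →
      cosetMean (colourInd f b) H (s u) ≤ 2 * α + diff u ^ 2 / α := by
    intro u b hb
    have h1 : |dens u b - cosetMean (colourInd f b) H (s u)| = |diff u| := by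
      cases b
      · simp only [hdens, hdiff, cosetMean_colourInd_false]
        rw [abs_sub_comm]
        congr 1
        ring
      · rfl
    have h2 := neg_abs_le (dens u b - cosetMean (colourInd f b) H (s u))
    have h3 : |diff u| ≤ α + diff u ^ 2 / α := by
      rw [← sq_abs, ← sub_nonneg]
      have : α + |diff u| ^ 2 / α - |diff u| =
          ((α - |diff u| / 2) ^ 2 + 3 / 4 * |diff u| ^ 2) / α := by
        field_simp
        ring
      rw [this]
      positivity
    rw [h1] at h2
    linarith
  have hclass : ∀ u, 𝔼 h : H, (if f (s u + h) ≠ g (s u + h) then (1 : ℝ) else 0) ≤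
      (if u = 0 then 1 else 0) + (4 * α + 2 / α * (if u ∈ S then diff u ^ 2 else 0)) := by
    intro u
    by_cases hu : u = 0
    · rw [if_pos hu, if_neg (fun h => (hS u).1 h hu)]
      refine (Finset.expect_le Finset.univ_nonempty (a := (1 : ℝ)) fun h _ => ?_).trans ?_
      · split_ifs <;> norm_num
      · linarith
    rw [if_neg hu, if_pos ((hS u).2 hu)]
    have h1 : ∀ h : H, (if f (s u + h) ≠ g (s u + h) then (1 : ℝ) else 0) ≤
        (if dens u true < α then colourInd f true (s u + h) else 0) +
          (if dens u false < α then colourInd f false (s u + h) else 0) := by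
      intro h
      by_cases hfg : f (s u + h) = g (s u + h)
      · rw [if_neg (not_not.2 hfg)]
        have := colourInd_nonneg f true (s u + h)
        have := colourInd_nonneg f false (s u + h)
        split_ifs <;> linarith
      rw [if_pos hfg]
      have h2 : dens u (f (s u + h)) < α := by
        by_contra h3
        refine hfg ?_
        simp only [hg, hmk, if_neg hu, if_pos (not_lt.1 h3)]
      have hnn := fun b => colourInd_nonneg f b (s u + h)
      cases hb : f (s u + h)
      · rw [hb] at h2
        rw [if_pos h2]
        have : colourInd f false (s u + h) = 1 := by simp [colourInd, hb]
        have := hnn true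
        split_ifs <;> linarith
      · rw [hb] at h2
        rw [if_pos h2]
        have : colourInd f true (s u + h) = 1 := by simp [colourInd, hb]
        have := hnn false
        split_ifs <;> linarith
    refine (Finset.expect_le_expect fun h _ => h1 h).trans ?_
    rw [Finset.expect_add_distrib]
    have h4 : ∀ b, 𝔼 h : H, (if dens u b < α then colourInd f b (s u + h) else 0)
        ≤ 2 * α + diff u ^ 2 / α := by
      intro b
      by_cases hb : dens u b < α
      · simp only [if_pos hb]
        exact hrare u b hb
      · simp only [if_neg hb, Finset.expect_const_zero]
        positivity
    refine (add_le_add (h4 true) (h4 false)).trans_eq ?_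
    ring
  refine (Finset.expect_le_expect fun u _ => hclass u).trans_eq ?_
  rw [Finset.expect_add_distrib, Finset.expect_add_distrib, Fintype.expect_const,
    ← Finset.mul_expect, Fintype.expect_eq_sum_div_card, Fintype.expect_eq_sum_div_card,
    ← Finset.sum_filter (fun u => u ∈ S)]
  simp [add_assoc, hdiff]

end Removal

/-- If `f` is uniform on the cosets `yᵢ + W` of a solution `y`, and the colour `σᵢ` is frequent on
`yᵢ + W`, then `f` induces the system at many points of these cosets. -/
lemma InducedSystem.le_ncard_inducedAt (S : InducedSystem) (hS : HasComplexityAtMost S.M 1)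
    {V W : Type} [AddCommGroup V] [Module (ZMod 2) V] [Finite V]
    [AddCommGroup W] [Module (ZMod 2) W] [Fintype W] (j : W →ₗ[ZMod 2] V)
    (hj : Function.Injective j) (f : V → Bool) {y : Fin S.k → V} (hy : y ∈ solutions S.M V)
    {η β : ℝ} (hη : 0 ≤ η) (hβ : 0 ≤ β)
    (hunif : ∀ i, IsUniform η fun w => colourInd f true (y i + j w))
    (hdens : ∀ i, β ≤ 𝔼 w, colourInd f (S.σ i) (y i + j w)) :
    (β ^ S.k - S.k * η) * (Fintype.card W : ℝ) ^ (S.k - S.M.rank) ≤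
      ({x : Fin S.k → V | S.InducedAt f x}.ncard : ℝ) := by
  have h1 := hS.le_expect_prod (W := W) (F := fun i w => colourInd f (S.σ i) (y i + j w)) hη
    (fun _ _ => colourInd_nonneg _ _ _) (fun _ _ => colourInd_le_one _ _ _)
    fun i => isUniform_colourInd (f := fun w => f (y i + j w)) (hunif i) (S.σ i)
  have h2 : β ^ S.k ≤ ∏ i, 𝔼 w, colourInd f (S.σ i) (y i + j w) := by
    calc β ^ S.k = ∏ _i : Fin S.k, β := by simp
      _ ≤ _ := Finset.prod_le_prod (fun _ _ => hβ) fun i _ => hdens i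
  set A : Finset (solutions S.M W) :=
    Finset.univ.filter fun z => ∀ i, f (y i + j (z.1 i)) = S.σ i with hA
  have h3 : 𝔼 z : solutions S.M W, ∏ i, colourInd f (S.σ i) (y i + j (z.1 i))
      = A.card / (Fintype.card W : ℝ) ^ (S.k - S.M.rank) := by
    have h4 : ∀ z : solutions S.M W, ∏ i, colourInd f (S.σ i) (y i + j (z.1 i))
        = if ∀ i, f (y i + j (z.1 i)) = S.σ i then 1 else 0 := fun z => by
      simp only [colourInd, Finset.prod_ite_zero, Finset.prod_const_one, Finset.mem_univ,
        true_imp_iff]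
    simp only [h4]
    rw [Fintype.expect_eq_sum_div_card, Finset.sum_boole, card_solutions]
    push_cast
    rfl
  rw [h3] at h1
  have hpos : (0 : ℝ) < (Fintype.card W : ℝ) ^ (S.k - S.M.rank) :=
    pow_pos (Nat.cast_pos.2 Fintype.card_pos) _
  have h5 : (β ^ S.k - S.k * η) * (Fintype.card W : ℝ) ^ (S.k - S.M.rank) ≤ A.card := by
    rw [← le_div_iff₀ hpos]
    linarith
  refine h5.trans (Nat.cast_le.2 ?_)
  have hinj : Function.Injective fun (z : solutions S.M W) i => y i + j (z.1 i) := by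
    intro z z' hzz
    refine Subtype.ext (funext fun i => hj ?_)
    exact add_left_cancel (congrFun hzz i)
  rw [← Set.ncard_coe_finset, ← Set.ncard_image_of_injective _ hinj]
  refine Set.ncard_le_ncard ?_ (Set.toFinite _)
  rintro _ ⟨z, hz, rfl⟩
  exact ⟨add_mem hy (map_mem_solutions z.2 j), (Finset.mem_filter.1 hz).2⟩

/-- A system of complexity at most one has a solution without zero entries. -/
lemma HasComplexityAtMost.exists_solution_ne_zero {m k c : ℕ}
    {M : Matrix (Fin m) (Fin k) (ZMod 2)} (h : HasComplexityAtMost M c) {K : ℕ} (hK : k ≤ K) :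
    ∃ z ∈ solutions M (Fin K → ZMod 2), ∀ i, z i ≠ 0 := by
  choose v hv hvi using h.exists_solution
  refine ⟨fun i a => if ha : a.1 < k then v ⟨a, ha⟩ i else 0, fun r => funext fun a => ?_,
    fun i h0 => ?_⟩
  · rw [Finset.sum_apply]
    by_cases ha : a.1 < k
    · simpa [ha] using hv ⟨a, ha⟩ r
    · simp [ha]
  · have := congrFun h0 (Fin.castLE hK i)
    simp [hvi] at this

/-- `P` allows the system: some solution takes values to which `P` allows the prescribed colours. -/
def InducedSystem.AllowedBy (S : InducedSystem) {r : ℕ} (P : Set (Cube r × Bool)) : Prop :=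
  ∃ u ∈ solutions S.M (Cube r), ∀ i, (u i, S.σ i) ∈ P

/-- As there are finitely many patterns `P` of given dimension, the patterns allowing some system
in `F` allow one of bounded size. -/
lemma exists_bound_allowedBy (F : Set InducedSystem) (r : ℕ) :
    ∃ K : ℕ, ∀ P : Set (Cube r × Bool), (∃ S ∈ F, S.AllowedBy P) →
      ∃ S ∈ F, S.k ≤ K ∧ S.AllowedBy P := by
  have h : ∀ P : Set (Cube r × Bool), ∃ K : ℕ, (∃ S ∈ F, S.AllowedBy P) →
      ∃ S ∈ F, S.k ≤ K ∧ S.AllowedBy P := fun P => by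
    by_cases hP : ∃ S ∈ F, S.AllowedBy P
    · obtain ⟨S, hSF, hS⟩ := hP
      exact ⟨S.k, fun _ => ⟨S, hSF, le_rfl, hS⟩⟩
    · exact ⟨0, fun h => (hP h).elim⟩
  choose K hK using h
  obtain ⟨B, hB⟩ := Finite.exists_le K
  refine ⟨B, fun P hP => ?_⟩
  obtain ⟨S, hSF, hk, hS⟩ := hK P hP
  exact ⟨S, hSF, hk.trans (hB P), hS⟩

lemma exists_submodule_codim {c n : ℕ} (hcn : c ≤ n) :
    ∃ H : Submodule (ZMod 2) (Cube n), Module.finrank (ZMod 2) (Cube n ⧸ H) = c := by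
  set Φ : Cube n →ₗ[ZMod 2] Cube c := LinearMap.funLeft (ZMod 2) (ZMod 2) (Fin.castLE hcn)
  have hΦ : Function.Surjective Φ :=
    LinearMap.funLeft_surjective_of_injective _ _ _ (Fin.castLE_injective hcn)
  refine ⟨LinearMap.ker Φ, ?_⟩
  rw [(Φ.quotKerEquivOfSurjective hΦ).finrank_eq, Module.finrank_fin_fun]

lemma card_quotient_eq_two_pow {V : Type*} [AddCommGroup V] [Module (ZMod 2) V] [Fintype V]
    (H : Submodule (ZMod 2) V) :
    Fintype.card (V ⧸ H) = 2 ^ Module.finrank (ZMod 2) (V ⧸ H) := by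
  rw [Module.card_eq_pow_finrank (K := ZMod 2), ZMod.card]

lemma card_eq_card_mul_two_pow {V : Type*} [AddCommGroup V] [Module (ZMod 2) V] [Fintype V]
    (H : Submodule (ZMod 2) V) :
    Fintype.card V = Fintype.card H * 2 ^ Module.finrank (ZMod 2) (V ⧸ H) := by
  rw [← card_quotient_eq_two_pow]
  simpa only [Nat.card_eq_fintype_card] using Submodule.card_eq_card_quotient_mul_card H

/-- The induced removal lemma for systems of complexity at most one. -/
theorem exists_induced_removal (F : Set InducedSystem)
    (hF : ∀ S ∈ F, HasComplexityAtMost S.M 1) {ε : ℝ} (hε : 0 < ε) (hε1 : ε < 1) :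
    ∃ (N K : ℕ) (δ : ℝ), 0 < δ ∧ δ ≤ 1 ∧ ∀ n : ℕ, N < n → ∀ f : Cube n → Bool,
      IsFar (freeness F) ε f → ∃ S ∈ F, S.k ≤ K ∧
        δ * 2 ^ (n * (S.k - S.M.rank)) ≤ ({x : Fin S.k → Cube n | S.InducedAt f x}.ncard : ℝ) := by
  set α : ℝ := ε / 16 with hα
  have hα0 : 0 < α := by positivity
  have hα1 : α ≤ 1 / 2 := by rw [hα]; linarith
  set β : ℝ := α / 2 with hβ
  have hβ0 : 0 < β := by positivity
  have hβ1 : β ≤ 1 := by rw [hβ]; linarith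
  obtain ⟨c₀, hc₀⟩ : ∃ c₀ : ℕ, 4 / ε ≤ 2 ^ c₀ := by
    obtain ⟨c₀, h⟩ := pow_unbounded_of_one_lt (4 / ε) (one_lt_two)
    exact ⟨c₀, h.le⟩
  choose K hK using exists_bound_allowedBy F
  set η₁ : ℕ → ℝ := fun r => β ^ K r / (2 * (K r + 1)) with hη₁
  have hη₁0 : ∀ r, 0 < η₁ r := fun r => by positivity
  choose t ht using fun r => exists_mono_cosets (K r) (hη₁0 r)
  -- The uniformity of the cosets of `H'` has to survive the passage to a subspace of
  -- codimension `t r`, and irregular cosets have to be avoided by a section over `2 ^ r` classes.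
  set η : ℕ → ℝ := fun r => min (min (η₁ r) β / 2 ^ t r) (1 / (4 * 2 ^ r)) with hη
  have hη0 : ∀ r, 0 < η r := fun r =>
    lt_min (div_pos (lt_min (hη₁0 r) hβ0) (by positivity)) (by positivity)
  have hη2 : ∀ r, 2 ^ t r * η r ≤ min (η₁ r) β := fun r => by
    rw [← le_div_iff₀' (by positivity)]
    exact min_le_left _ _
  have hη3 : ∀ r, η r * 2 ^ r ≤ 1 / 4 := fun r => by
    rw [← le_div_iff₀ (by positivity), div_div]
    exact min_le_right _ _
  set ε' : ℝ := α * ε / 16 with hε'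
  have hε'0 : 0 < ε' := by positivity
  obtain ⟨R, hR⟩ := exists_strongly_regular_pair c₀ hε'0 η hη0
  set K' : ℕ := ∑ r ∈ Finset.range (R + 1), K r with hK'
  set t' : ℕ := ∑ r ∈ Finset.range (R + 1), t r with ht'
  set δ : ℝ := β ^ K' / 2 / 2 ^ ((R + t') * K') with hδ
  refine ⟨c₀, K', δ, by positivity, ?_, fun n hn f hfar => ?_⟩
  · rw [hδ]
    refine div_le_one_of_le₀ ?_ (by positivity)
    have h1 : β ^ K' ≤ 1 := pow_le_one₀ hβ0.le hβ1
    have h2 : (1 : ℝ) ≤ 2 ^ ((R + t') * K') := one_le_pow₀ one_le_two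
    linarith
  obtain ⟨H₀, hH₀⟩ := exists_submodule_codim hn.le
  obtain ⟨H, hHH₀, H', hle, hcodim', hirr, hen⟩ := hR (Cube n) (colourInd f true)
    (colourInd_nonneg f true) (colourInd_le_one f true) H₀ hH₀
  set r := Module.finrank (ZMod 2) (Cube n ⧸ H) with hr
  have hcodim_mono : ∀ {A B : Submodule (ZMod 2) (Cube n)}, A ≤ B →
      Module.finrank (ZMod 2) (Cube n ⧸ B) ≤ Module.finrank (ZMod 2) (Cube n ⧸ A) := by
    intro A B hAB
    have := Submodule.finrank_mono hAB
    have h1 := A.finrank_quotient_add_finrank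
    have h2 := B.finrank_quotient_add_finrank
    omega
  have hrc : c₀ ≤ r := hH₀ ▸ hcodim_mono hHH₀
  have hrR : r ≤ R := (hcodim_mono hle).trans hcodim'
  have hKr : K r ≤ K' := Finset.single_le_sum (f := K) (fun _ _ => Nat.zero_le _)
    (Finset.mem_range.2 (by omega))
  have htr : t r ≤ t' := Finset.single_le_sum (f := t) (fun _ _ => Nat.zero_le _)
    (Finset.mem_range.2 (by omega))
  have hC : (Fintype.card (Cube n ⧸ H) : ℝ) = 2 ^ r := by
    rw [card_quotient_eq_two_pow]; push_cast; rfl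
  obtain ⟨T, hT⟩ : ∃ T : Finset (Cube n ⧸ H), ∀ u, u ∈ T ↔ u ≠ 0 := by
    classical exact ⟨Finset.univ.erase 0, by simp⟩
  obtain ⟨s, hs, hsunif, hsdiff⟩ := exists_good_section (colourInd f true) hle hε'0
    (by rw [hC]; exact hη3 r) hirr hen hT
  obtain ⟨H'', φ, c, hcodim'', hφ⟩ := ht r H' fun x => f x
  obtain ⟨g, hg0, hg1, hdist⟩ := exists_recolouring f H H' c hα0 hα1 hs hT
  -- The recoloured function is too close to `f` to be free.
  have hclose : (hammingDist f g : ℝ) < ε * 2 ^ n := by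
    have hV : (Fintype.card (Cube n) : ℝ) = 2 ^ n := by simp
    refine hdist.trans_lt ?_
    rw [hV, mul_comm ε]
    refine mul_lt_mul_of_pos_left ?_ (by positivity)
    have h1 : 1 / (Fintype.card (Cube n ⧸ H) : ℝ) ≤ ε / 4 := by
      rw [hC, div_le_iff₀ (by positivity)]
      have h2 : (2 : ℝ) ^ c₀ ≤ 2 ^ r := pow_le_pow_right₀ one_le_two hrc
      have h3 : ε / 4 * (4 / ε) = 1 := by field_simp
      nlinarith
    have h4 : (∑ u ∈ T, (cosetMean (colourInd f true) H' (s u) -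
          cosetMean (colourInd f true) H (s u)) ^ 2) / (Fintype.card (Cube n ⧸ H) : ℝ)
          ≤ 2 * ε' := by
      rw [div_le_iff₀ (by rw [hC]; positivity)]
      exact hsdiff
    have h5 : 2 / α * (2 * ε') = ε / 4 := by
      rw [hε']
      field_simp
      norm_num
    have h6 := mul_le_mul_of_nonneg_left h4 (show 0 ≤ 2 / α by positivity)
    linarith
  have hnotfree : ¬ IsFree F g := fun hfree => absurd (hfar g hfree) (not_le.2 hclose)
  simp only [IsFree, not_forall, not_not] at hnotfree
  obtain ⟨S₀, hS₀F, x, hx, hxσ⟩ := hnotfree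
  -- The pattern of colours that the recoloured function may take.
  let e : (Cube n ⧸ H) ≃ₗ[ZMod 2] Cube r := LinearEquiv.ofFinrankEq _ _ (by simp [hr])
  let P : Set (Cube r × Bool) := {p | (p.1 = 0 → p.2 = c) ∧
    (p.1 ≠ 0 → α ≤ cosetMean (colourInd f p.2) H' (s (e.symm p.1)))}
  have hS₀P : S₀.AllowedBy P := by
    refine ⟨fun i => e (H.mkQ (x i)), map_mem_solutions (map_mem_solutions hx H.mkQ) e.toLinearMap,
      fun i => ⟨fun h0 => ?_, fun h0 => ?_⟩⟩
    · rw [← hxσ i]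
      exact hg0 _ ((map_eq_zero_iff e e.injective).1 h0)
    · have h1 := hg1 (x i) fun h => h0 (by simp only [h, map_zero])
      rw [hxσ i] at h1
      simpa only [e.symm_apply_apply] using h1
  obtain ⟨S, hSF, hSk, u, hu, huP⟩ := hK r P ⟨S₀, hS₀F, hS₀P⟩
  obtain ⟨z, hz, hz0⟩ := (hF S hSF).exists_solution_ne_zero hSk
  refine ⟨S, hSF, hSk.trans hKr, ?_⟩
  have hy : (fun i => s (e.symm (u i)) + (φ (z i) : Cube n)) ∈ solutions S.M (Cube n) :=
    add_mem (map_mem_solutions (map_mem_solutions hu e.symm.toLinearMap) s)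
      (map_mem_solutions (map_mem_solutions hz φ) H'.subtype)
  have hcard'' : (Fintype.card (H' ⧸ H'') : ℝ) * η r ≤ min (η₁ r) β := by
    rw [card_quotient_eq_two_pow]
    push_cast
    refine le_trans (mul_le_mul_of_nonneg_right ?_ (hη0 r).le) (hη2 r)
    exact pow_le_pow_right₀ one_le_two hcodim''
  have hunif : ∀ i, IsUniform (η₁ r) fun w : H'' =>
      colourInd f true (s (e.symm (u i)) + (φ (z i) : Cube n) + H'.subtype (H''.subtype w)) := by
    intro i
    by_cases hui : u i = 0
    · have := (hφ (z i) (hz0 i)).1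
      simp only [hui, map_zero, zero_add]
      exact this
    · have h1 := hsunif (e.symm (u i)) fun h => hui ((map_eq_zero_iff e.symm e.symm.injective).1 h)
      have h2 := ((h1.translate (φ (z i))).restrict H'').mono (hcard''.trans (min_le_left _ _))
      simpa only [Submodule.coe_add, ← add_assoc, Submodule.subtype_apply] using h2
  have hdens : ∀ i, β ≤ 𝔼 w : H'',
      colourInd f (S.σ i) (s (e.symm (u i)) + (φ (z i) : Cube n) +
        H'.subtype (H''.subtype w)) := by
    intro i
    by_cases hui : u i = 0
    · have h1 := (hφ (z i) (hz0 i)).2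
      rw [← (huP i).1 hui] at h1
      have h2 : β ≤ cosetMean (colourInd (fun x : H' => f x) (S.σ i)) H'' (φ (z i)) := by
        rw [hβ]; linarith
      simp only [hui, map_zero, zero_add]
      exact h2
    · have h1 := isUniform_colourInd (f := fun h : H' => f (s (e.symm (u i)) + h))
        (hsunif (e.symm (u i)) fun h => hui ((map_eq_zero_iff e.symm e.symm.injective).1 h)) (S.σ i)
      have h2 := (h1.translate (φ (z i))).abs_expect_restrict_sub_le (hη0 r).le H''
      rw [expect_translate (colourInd (fun h : H' => f (s (e.symm (u i)) + h)) (S.σ i))] at h2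
      have h3 : α ≤ 𝔼 h : H', colourInd (fun h : H' => f (s (e.symm (u i)) + h)) (S.σ i) h :=
        (huP i).2 hui
      have h4 := neg_abs_le (𝔼 w : H'', colourInd (fun h : H' => f (s (e.symm (u i)) + h)) (S.σ i)
        (φ (z i) + w) -
          𝔼 h : H', colourInd (fun h : H' => f (s (e.symm (u i)) + h)) (S.σ i) h)
      have h5 := hcard''.trans (min_le_right _ _)
      have h6 : β ≤ 𝔼 w : H'', colourInd (fun h : H' => f (s (e.symm (u i)) + h)) (S.σ i)
          (φ (z i) + w) := by
        rw [hβ] at h5 ⊢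
        linarith
      refine h6.trans_eq (Finset.expect_congr rfl fun w _ => ?_)
      exact congrArg (colourInd f (S.σ i)) (add_assoc _ _ _).symm
  have hcount := S.le_ncard_inducedAt (hF S hSF) (H'.subtype ∘ₗ H''.subtype)
    (Subtype.val_injective.comp Subtype.val_injective) f hy (hη₁0 r).le hβ0.le hunif hdens
  refine le_trans ?_ hcount
  have hW : (2 : ℝ) ^ n ≤ Fintype.card H'' * 2 ^ (R + t') := by
    have h1 : (Fintype.card (Cube n) : ℝ) = Fintype.card H'' *
        2 ^ Module.finrank (ZMod 2) (H' ⧸ H'') * 2 ^ Module.finrank (ZMod 2) (Cube n ⧸ H') := by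
      rw [card_eq_card_mul_two_pow H', card_eq_card_mul_two_pow H'']
      push_cast
      rfl
    have h2 : (Fintype.card (Cube n) : ℝ) = 2 ^ n := by simp
    rw [← h2, h1, mul_assoc, ← pow_add]
    refine mul_le_mul_of_nonneg_left (pow_le_pow_right₀ one_le_two ?_) (Nat.cast_nonneg _)
    omega
  have hρ : S.k - S.M.rank ≤ K' := (Nat.sub_le _ _).trans (hSk.trans hKr)
  have hcoef : β ^ K' / 2 ≤ β ^ S.k - S.k * η₁ r := by
    have h1 : β ^ K r ≤ β ^ S.k := pow_le_pow_of_le_one hβ0.le hβ1 hSk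
    have h2 : β ^ K' ≤ β ^ K r := pow_le_pow_of_le_one hβ0.le hβ1 hKr
    have h3 : (S.k : ℝ) * η₁ r ≤ β ^ K r / 2 := by
      have h4 : (S.k : ℝ) ≤ K r + 1 := by
        have : (S.k : ℝ) ≤ K r := Nat.cast_le.2 hSk
        linarith
      calc (S.k : ℝ) * η₁ r ≤ (K r + 1) * η₁ r := mul_le_mul_of_nonneg_right h4 (hη₁0 r).le
        _ = β ^ K r / 2 := by
          simp only [hη₁]
          field_simp
    linarith
  calc δ * 2 ^ (n * (S.k - S.M.rank))
      ≤ δ * ((Fintype.card H'' : ℝ) ^ (S.k - S.M.rank) * 2 ^ ((R + t') * K')) := by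
        refine mul_le_mul_of_nonneg_left ?_ (by positivity)
        rw [pow_mul]
        refine (pow_le_pow_left₀ (by positivity) hW _).trans ?_
        rw [mul_pow, ← pow_mul]
        refine mul_le_mul_of_nonneg_left ?_ (by positivity)
        exact pow_le_pow_right₀ one_le_two (Nat.mul_le_mul_left _ hρ)
    _ = β ^ K' / 2 * (Fintype.card H'' : ℝ) ^ (S.k - S.M.rank) := by
        rw [hδ]
        field_simp
    _ ≤ _ := mul_le_mul_of_nonneg_right hcoef (by positivity)

/-! ### Query algorithms -/

lemma QueryTree.run_queryAll {X : Type} [DecidableEq X] (decision : (X → Bool) → Bool)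
    (f : X → Bool) (L : List X) (g : X → Bool) :
    (queryAll decision L g).run f = decision fun x => if x ∈ L then f x else g x := by
  induction L generalizing g with
  | nil => simp [queryAll, run]
  | cons y L ih =>
    simp only [queryAll, run]
    rw [ih]
    congr 1
    funext x
    by_cases hx : x = y
    · subst hx
      simp
    · simp [hx]

lemma QueryTree.queries_queryAll {X : Type} [DecidableEq X] (decision : (X → Bool) → Bool)
    (L : List X) (g : X → Bool) : (queryAll decision L g).queries = L.length := by
  induction L generalizing g with
  | nil => rfl
  | cons y L ih => simp only [queryAll, queries, ih, max_self, List.length_cons]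

lemma run_subspaceTest (F : Set InducedSystem) {n : ℕ} (H : Submodule (ZMod 2) (Cube n))
    (f : Cube n → Bool) :
    (subspaceTest F H).run f = true ↔ IsFree F fun v : H => f v := by
  classical
  rw [subspaceTest, QueryTree.run_queryAll, decide_eq_true_iff]
  refine iff_of_eq (congrArg (IsFree F) (funext fun v => ?_))
  exact if_pos (by simp)

lemma queries_subspaceTest (F : Set InducedSystem) {n : ℕ} (H : Submodule (ZMod 2) (Cube n)) :
    (subspaceTest F H).queries = 2 ^ Module.finrank (ZMod 2) H := by
  rw [subspaceTest, QueryTree.queries_queryAll, Finset.length_toList,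
    ← Fintype.card_subtype]
  exact Module.card_eq_pow_finrank (K := ZMod 2) (V := H)

lemma not_isFree_restrict {F : Set InducedSystem} {S : InducedSystem} (hS : S ∈ F) {V : Type}
    [AddCommGroup V] [Module (ZMod 2) V] {H : Submodule (ZMod 2) V} {f : V → Bool}
    {x : Fin S.k → V} (hx : S.InducedAt f x) (hxH : ∀ i, x i ∈ H) :
    ¬ IsFree F fun v : H => f v := by
  refine fun h => h S hS ⟨fun i => ⟨x i, hxH i⟩, fun r => Subtype.ext ?_, hx.2⟩
  have := hx.1 r
  simpa using this

lemma IsFree.restrict {F : Set InducedSystem} {V : Type} [AddCommGroup V] [Module (ZMod 2) V]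
    {f : V → Bool} (h : IsFree F f) (H : Submodule (ZMod 2) V) : IsFree F fun v : H => f v := by
  rintro S hS ⟨x, hx, hxσ⟩
  exact h S hS ⟨fun i => x i, map_mem_solutions hx H.subtype, hxσ⟩

lemma IsFar.not_isFree {F : Set InducedSystem} {ε : ℝ} (hε : 0 < ε) {n : ℕ} {f : Cube n → Bool}
    (h : IsFar (freeness F) ε f) : ¬ IsFree F f := by
  intro hf
  have h1 := h f hf
  rw [hammingDist_self, Nat.cast_zero] at h1
  have : 0 < ε * 2 ^ n := by positivity
  linarith

lemma verdictProb_eq_one {n : ℕ} {T : RandomizedTester n} {f : Cube n → Bool} {b : Bool}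
    (h : ∀ t ∈ T.support, t.run f = b) : verdictProb T f b = 1 := by
  rw [verdictProb, PMF.apply_eq_one_iff, PMF.support_map]
  ext b'
  constructor
  · rintro ⟨t, ht, rfl⟩
    exact h t ht
  · rintro rfl
    obtain ⟨t, ht⟩ := T.support_nonempty
    exact ⟨t, ht, h t ht⟩

lemma verdictProb_uniform {n : ℕ} {Ω : Type} [Fintype Ω] [Nonempty Ω]
    (A : Ω → QueryTree (Cube n)) (f : Cube n → Bool) (b : Bool) :
    verdictProb ((PMF.uniformOfFintype Ω).map A) f b =
      ENNReal.ofReal (((Finset.univ.filter fun D => (A D).run f = b).card : ℝ) /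
        Fintype.card Ω) := by
  rw [verdictProb, PMF.map_comp, ← PMF.toOuterMeasure_apply_singleton, PMF.toOuterMeasure_map_apply,
    PMF.toOuterMeasure_uniformOfFintype_apply, ENNReal.ofReal_div_of_pos
      (Nat.cast_pos.2 Fintype.card_pos), ENNReal.ofReal_natCast, ENNReal.ofReal_natCast]
  congr 2
  rw [← Fintype.card_subtype]
  exact Fintype.card_congr (Equiv.refl _)

/-! ### Analysis of the tester -/

/-- Among `d` random points there are many disjoint blocks of length `l`. The proportion of the
choices for which all blocks avoid a given set of `l`-tuples is exponentially small. -/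
lemma card_avoiding_le {V : Type} [Fintype V] [Nonempty V] {d l B : ℕ} (hB : B * l ≤ d)
    (A : Finset (Fin l → V)) {δ : ℝ} (hA : δ * (Fintype.card V : ℝ) ^ l ≤ A.card)
    (Q : (Fin d → V) → Prop) [DecidablePred Q]
    (hQ : ∀ D, Q D → ∀ p ∈ A, ¬ Set.range p ⊆ Set.range D) :
    ((Finset.univ.filter Q).card : ℝ) ≤ (1 - δ) ^ B * (Fintype.card V : ℝ) ^ d := by
  classical
  have e : (Fin B × Fin l) ⊕ Fin (d - B * l) ≃ Fin d :=
    Fintype.equivOfCardEq (by simp; omega)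
  let E : (Fin d → V) ≃ (Fin B → Fin l → V) × (Fin (d - B * l) → V) :=
    (e.symm.arrowCongr (Equiv.refl V)).trans
      ((Equiv.sumArrowEquivProdArrow _ _ _).trans
        ((Equiv.curry _ _ _).prodCongr (Equiv.refl _)))
  have hE : ∀ D b a, (E D).1 b a = D (e (Sum.inl (b, a))) := fun D b a => rfl
  have h1 : (Finset.univ.filter Q).card ≤
      ((Fintype.piFinset fun _ : Fin B => Aᶜ) ×ˢ
        (Finset.univ : Finset (Fin (d - B * l) → V))).card := by
    refine Finset.card_le_card_of_injOn E (fun D hD => ?_) E.injective.injOn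
    simp only [Finset.coe_product, Set.mem_prod, Finset.mem_coe, Fintype.mem_piFinset,
      Finset.mem_compl, Finset.mem_univ, and_true]
    intro b hb
    refine hQ D (Finset.mem_filter.1 hD).2 _ hb ?_
    rintro _ ⟨a, rfl⟩
    exact ⟨_, (hE D b a).symm⟩
  have h2 : ((Aᶜ.card : ℕ) : ℝ) ≤ (1 - δ) * (Fintype.card V : ℝ) ^ l := by
    rw [Finset.card_compl, Nat.cast_sub (Finset.card_le_univ _), Fintype.card_fun, Fintype.card_fin]
    push_cast
    linarith
  calc ((Finset.univ.filter Q).card : ℝ)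
      ≤ ((Aᶜ.card : ℕ) : ℝ) ^ B * (Fintype.card V : ℝ) ^ (d - B * l) := by
        refine (Nat.cast_le.2 h1).trans_eq ?_
        rw [Finset.card_product, Fintype.card_piFinset_const, Finset.card_univ, Fintype.card_fun,
          Fintype.card_fin]
        push_cast
        rfl
    _ ≤ ((1 - δ) * (Fintype.card V : ℝ) ^ l) ^ B * (Fintype.card V : ℝ) ^ (d - B * l) := by
        gcongr
    _ = (1 - δ) ^ B * (Fintype.card V : ℝ) ^ d := by
        rw [mul_pow, ← pow_mul, mul_assoc, ← pow_add]
        congr 2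
        rw [mul_comm l B]
        omega

lemma one_sub_pow_le_third {δ : ℝ} (hδ : 0 < δ) (hδ1 : δ ≤ 1) {k l d : ℕ} (hl : 0 < l)
    (hlk : l ≤ k) (hd : 3 * k / δ ≤ d) : (1 - δ) ^ (d / l) ≤ 1 / 3 := by
  have hl' : (0 : ℝ) < l := Nat.cast_pos.2 hl
  have h1 : (d : ℝ) < (d / l : ℕ) * l + l := by
    have := Nat.lt_div_mul_add (a := d) hl
    exact_mod_cast this
  have h2 : 3 * (l : ℝ) ≤ d * δ := by
    rw [div_le_iff₀ hδ] at hd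
    have : (l : ℝ) ≤ k := Nat.cast_le.2 hlk
    linarith
  have h3 : 2 ≤ δ * (d / l : ℕ) := by
    have h4 : 3 * (l : ℝ) < ((d / l : ℕ) * l + l) * δ :=
      h2.trans_lt (mul_lt_mul_of_pos_right h1 hδ)
    have h5 : (3 : ℝ) < ((d / l : ℕ) + 1) * δ := by
      refine lt_of_mul_lt_mul_right ?_ hl'.le
      linarith
    linarith
  calc (1 - δ) ^ (d / l) ≤ Real.exp (-δ) ^ (d / l) :=
        pow_le_pow_left₀ (by linarith) (Real.one_sub_le_exp_neg δ) _
    _ = Real.exp (-(δ * (d / l : ℕ))) := by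
        rw [← Real.exp_nat_mul]
        congr 1
        ring
    _ ≤ Real.exp (-2) := Real.exp_le_exp.2 (by linarith)
    _ ≤ 1 / 3 := by
        rw [Real.exp_neg, one_div]
        have := Real.add_one_le_exp 2
        exact inv_anti₀ (by norm_num) (by linarith)

lemma HasComplexityAtMost.rank_lt {m k c : ℕ} {M : Matrix (Fin m) (Fin k) (ZMod 2)}
    (h : HasComplexityAtMost M c) (hk : 0 < k) : 0 < k - M.rank := by
  obtain ⟨v, hv, hvi⟩ := h.exists_solution ⟨0, hk⟩
  rw [← finrank_solutions, Module.finrank_pos_iff]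
  refine ⟨⟨v, hv⟩, 0, fun h0 => ?_⟩
  have h1 : v = 0 := congrArg Subtype.val h0
  rw [h1] at hvi
  exact zero_ne_one hvi

/-- The span of a bounded number of random points witnesses a frequently induced system with
probability at least `2 / 3`. -/
lemma isOneSidedTester_spanTester {F : Set InducedSystem}
    (hF : ∀ S ∈ F, HasComplexityAtMost S.M 1) {N k : ℝ → ℕ} {δ : ℝ → ℝ}
    (hadm : AdmissibleParameters F N k δ) {ε : ℝ} (hε : 0 < ε) (hε1 : ε < 1) (n : ℕ) :
    IsOneSidedTester (freeness F) ε (max (2 ^ N ε) (2 ^ ⌈3 * k ε / δ ε⌉₊))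
      (spanTester F (N ε) ⌈3 * k ε / δ ε⌉₊ n) := by
  obtain ⟨hδ, hδ1, hadm⟩ := hadm ε hε hε1
  set d := ⌈3 * k ε / δ ε⌉₊ with hd
  have hd' : 3 * k ε / δ ε ≤ (d : ℝ) := Nat.le_ceil _
  have hsupp : ∀ t ∈ (spanTester F (N ε) d n).support, ∃ H : Submodule (ZMod 2) (Cube n),
      t = subspaceTest F H ∧ 2 ^ Module.finrank (ZMod 2) H ≤ max (2 ^ N ε) (2 ^ d) := by
    intro t ht
    unfold spanTester at ht
    split_ifs at ht with hn
    · rw [PMF.support_pure, Set.mem_singleton_iff] at ht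
      refine ⟨⊤, ht, le_max_of_le_left ?_⟩
      rw [finrank_top, Module.finrank_fin_fun]
      exact Nat.pow_le_pow_right two_pos hn
    · rw [PMF.support_map] at ht
      obtain ⟨D, -, rfl⟩ := ht
      refine ⟨_, rfl, le_max_of_le_right (Nat.pow_le_pow_right two_pos ?_)⟩
      exact (finrank_range_le_card (R := ZMod 2) D).trans_eq (Fintype.card_fin d)
  refine ⟨fun t ht => ?_, fun f hf => ?_, fun f hf => ?_⟩
  · obtain ⟨H, rfl, hH⟩ := hsupp t ht
    rwa [queries_subspaceTest]
  · refine verdictProb_eq_one fun t ht => ?_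
    obtain ⟨H, rfl, -⟩ := hsupp t ht
    rw [run_subspaceTest]
    exact IsFree.restrict hf H
  · by_cases hn : n ≤ N ε
    · rw [verdictProb_eq_one]
      · exact ENNReal.div_le_of_le_mul (by norm_num)
      intro t ht
      rw [spanTester, if_pos hn, PMF.support_pure, Set.mem_singleton_iff] at ht
      have hnf := hf.not_isFree hε
      simp only [IsFree, not_forall, not_not] at hnf
      obtain ⟨S, hS, x, hx⟩ := hnf
      rw [ht, ← Bool.not_eq_true, run_subspaceTest]
      exact not_isFree_restrict hS hx fun _ => Submodule.mem_top
    · obtain ⟨S, hSF, hSk, hcount⟩ := hadm n (not_le.1 hn) f hf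
      have hρ : 0 < S.k - S.M.rank :=
        (hF S hSF).rank_lt (Nat.zero_lt_two.trans S.two_lt_k)
      obtain ⟨e, he⟩ := exists_solutions_param S.M (Cube n)
      classical
      set A : Finset (Fin (S.k - S.M.rank) → Cube n) :=
        Finset.univ.filter fun p => S.InducedAt f (e p).1 with hA
      have hAcard : {x : Fin S.k → Cube n | S.InducedAt f x}.ncard = A.card := by
        have h1 : {x : Fin S.k → Cube n | S.InducedAt f x} = (fun p => (e p).1) '' (A : Set _) := by
          ext x
          constructor
          · intro hx
            refine ⟨e.symm ⟨x, hx.1⟩, ?_, ?_⟩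
            · simpa [hA] using hx
            · simp
          · rintro ⟨p, hp, rfl⟩
            exact (Finset.mem_filter.1 hp).2
        have hinj : Function.Injective fun p => (e p).1 := Subtype.val_injective.comp e.injective
        rw [h1, Set.ncard_image_of_injective _ hinj, Set.ncard_coe_finset]
      rw [hAcard] at hcount
      have hV : (Fintype.card (Cube n) : ℝ) = 2 ^ n := by simp
      set T : (Fin d → Cube n) → QueryTree (Cube n) :=
        fun D => subspaceTest F (Submodule.span (ZMod 2) (Set.range D)) with hT
      have hacc := card_avoiding_le (V := Cube n) (d := d) (Nat.div_mul_le_self d (S.k - S.M.rank))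
        A (by rw [hV, ← pow_mul]; exact hcount) (fun D => (T D).run f = true)
        (fun D hD p hp hsub => by
          refine not_isFree_restrict hSF (Finset.mem_filter.1 hp).2 (fun i => ?_)
            ((run_subspaceTest F _ f).1 hD)
          exact Submodule.span_mono hsub (he p i))
      have hthird := one_sub_pow_le_third hδ hδ1 hρ ((Nat.sub_le _ _).trans hSk) hd'
      rw [spanTester, if_neg hn, verdictProb_uniform]
      have h23 : (2 / 3 : ENNReal) = ENNReal.ofReal (2 / 3) := by
        rw [ENNReal.ofReal_div_of_pos (by norm_num)]
        norm_num
      rw [h23]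
      refine ENNReal.ofReal_le_ofReal ?_
      have hΩ : (Fintype.card (Fin d → Cube n) : ℝ) = (Fintype.card (Cube n) : ℝ) ^ d := by
        rw [Fintype.card_fun, Fintype.card_fin]
        push_cast
        rfl
      have hΩ0 : (0 : ℝ) < (Fintype.card (Cube n) : ℝ) ^ d := by rw [hV]; positivity
      have hsplit := Finset.card_filter_add_card_filter_not (s := Finset.univ)
        fun D : Fin d → Cube n => (T D).run f = true
      simp only [Bool.not_eq_true] at hsplit
      have hsplit' : ((Finset.univ.filter fun D => (T D).run f = true).card : ℝ) +
          (Finset.univ.filter fun D => (T D).run f = false).card =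
            (Fintype.card (Cube n) : ℝ) ^ d := by
        rw [← hΩ, ← Finset.card_univ, ← hsplit]
        push_cast
        rfl
      change 2 / 3 ≤ ((Finset.univ.filter fun D => (T D).run f = false).card : ℝ) / _
      rw [hΩ, le_div_iff₀ hΩ0]
      have h3 := mul_le_mul_of_nonneg_right hthird hΩ0.le
      linarith

/-! ### Admissible parameters and testability -/

lemma exists_admissibleParameters (F : Set InducedSystem)
    (hF : ∀ S ∈ F, HasComplexityAtMost S.M 1) :
    ∃ (N k : ℝ → ℕ) (δ : ℝ → ℝ), AdmissibleParameters F N k δ := by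
  have h : ∀ ε : ℝ, ∃ (N K : ℕ) (δ : ℝ), 0 < ε → ε < 1 → 0 < δ ∧ δ ≤ 1 ∧ ∀ n : ℕ, N < n →
      ∀ f : Cube n → Bool, IsFar (freeness F) ε f → ∃ S ∈ F, S.k ≤ K ∧
        δ * 2 ^ (n * (S.k - S.M.rank)) ≤ ({x : Fin S.k → Cube n | S.InducedAt f x}.ncard : ℝ) := by
    intro ε
    by_cases hε : 0 < ε ∧ ε < 1
    · obtain ⟨N, K, δ, h⟩ := exists_induced_removal F hF hε.1 hε.2
      exact ⟨N, K, δ, fun _ _ => h⟩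
    · exact ⟨0, 0, 0, fun h0 h1 => (hε ⟨h0, h1⟩).elim⟩
  choose N K δ h using h
  exact ⟨N, K, δ, fun ε hε hε1 => h ε hε hε1⟩

theorem mainTheorem2 :
    ∃ C : ℝ, 0 < C ∧
      ∀ F : Set InducedSystem, (∀ S ∈ F, HasComplexity S.M 1) →
        TestableOneSided (freeness F) ∧
        (∃ (N k : ℝ → ℕ) (δ : ℝ → ℝ), AdmissibleParameters F N k δ) ∧
        ∀ (N k : ℝ → ℕ) (δ : ℝ → ℝ), AdmissibleParameters F N k δ →
          ∀ ε : ℝ, 0 < ε → ε < 1 → ∀ n : ℕ,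
            IsOneSidedTester (freeness F) ε (max (2 ^ N ε) (2 ^ ⌈C * k ε / δ ε⌉₊))
              (spanTester F (N ε) ⌈C * k ε / δ ε⌉₊ n) := by
  refine ⟨3, by norm_num, fun F hF => ?_⟩
  have hF' : ∀ S ∈ F, HasComplexityAtMost S.M 1 := fun S hS => (hF S hS).hasComplexityAtMost_one
  obtain ⟨N, k, δ, hadm⟩ := exists_admissibleParameters F hF'
  refine ⟨⟨fun ε => max (2 ^ N ε) (2 ^ ⌈3 * k ε / δ ε⌉₊), fun ε hε hε1 n =>
    ⟨spanTester F (N ε) ⌈3 * k ε / δ ε⌉₊ n, ?_⟩⟩, ⟨N, k, δ, hadm⟩,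
    fun N k δ hadm ε hε hε1 n => ?_⟩
  · exact isOneSidedTester_spanTester hF' hadm hε hε1 n
  · exact isOneSidedTester_spanTester hF' hadm hε hε1 n
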